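/- Let $\mathbb D$ be the unit disk and $\mathbb D^*=\{|w|>1\}$. Let $f$ be one of the following. (a) A model function: $f=e^{\tau}$ on $\Omega=\bigcup_j\Omega_j$, where $(\Omega_j)$ is a (finite or infinite) family of simply connected unbounded domains in $\mathbb C$ and, for each $j$, $\tau$ maps $\Omega_j$ conformally onto $\{\operatorname{Re} z>0\}$, with an inverse $\varphi_j$ satisfying $|\varphi_j(\xi)|\to\infty$ as $|\xi|\to\infty$. (b) A transcendental entire function of class $\mathcal B$ (that is, the closure $S(f)$ of the set of critical values and finite asymptotic values of $f$ is bounded) with $S(f)\subset\mathbb D$; in this case put $\Omega=f^{-1}(\mathbb D^*)$. Assume that $0\notin\Omega$. For $t\ge 0$ and $w\in\mathbb D^*$ let $$\mathcal L_t 1(w)=\sum_{z\in\Omega,\ f(z)=w}|f'(z)|_1^{-t}\in[0,\infty],\qquad |f'(z)|_1=|f'(z)|\frac{|z|}{|f(z)|}.$$ Suppose that there are $s>0$ and $w_0\in\mathbb D^*$ with $\mathcal L_t 1(w_0)<\infty$ for every $t>s$. Let $\tilde\gamma\in(0,1)$. Then $$\sup_{|w|>e^{\tilde\gamma}}\mathcal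 L_t 1(w)<\infty\qquad\text{for every } t>s .$$ Moreover, for all $t>s$ and $p>1$ with $\frac1p<\frac ts-1$ there is a constant $C_{p,t}$ (independent of $w$) such that $$\mathcal L_t 1(w)\le\frac{C_{p,t}}{(\log|w|)^{1/p}}\qquad\text{for all } |w|>e^{\tilde\gamma}.$$ -/

import Mathlib

open Set Filter Topology Bornology
open scoped ENNReal

namespace LogTract

/-- The right half-plane `Re z > 0`. -/
def halfPlane : Set ℂ := {z | 0 < z.re}

/-- `a` is a (finite) asymptotic value of `f`: the limit of `f` along a curve tending to `∞`. -/
def IsAsymptoticValue (f : ℂ → ℂ) (a : ℂ) : Prop :=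
  ∃ γ : ℝ → ℂ, ContinuousOn γ (Ici 0) ∧ Tendsto γ atTop (cobounded ℂ) ∧
    Tendsto (fun r => f (γ r)) atTop (𝓝 a)

/-- The set of critical values of `f`. -/
def criticalValues (f : ℂ → ℂ) : Set ℂ := f '' {z | deriv f z = 0}

/-- The singular set `S(f)`: the closure of the set of critical values and finite asymptotic
values. -/
def singularSet (f : ℂ → ℂ) : Set ℂ :=
  closure (criticalValues f ∪ {a | IsAsymptoticValue f a})

/-- The Eremenko--Lyubich class: transcendental entire functions with bounded singular set. -/
structure IsClassB (f : ℂ → ℂ) : Prop where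
  entire : Differentiable ℂ f
  transcendental : ∀ P : Polynomial ℂ, f ≠ fun z => P.eval z
  bounded : IsBounded (singularSet f)

/-- A tract model: a family `𝒯` (finite or not) of simply connected unbounded domains, together
with a map `τ` on their union whose restriction to each of them is a conformal bijection onto the
right half-plane, with inverse extending continuously to infinity.
(Two different members of `𝒯` are automatically disjoint: on a common point the two inverse maps
would have the same germ, hence coincide on the half-plane.) -/
structure IsTractModel (τ : ℂ → ℂ) (𝒯 : Set (Set ℂ)) : Prop where
  isOpen : ∀ Ω ∈ 𝒯, IsOpen Ω
  simplyConnected : ∀ Ω ∈ 𝒯, IsSimplyConnected Ω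
  unbounded : ∀ Ω ∈ 𝒯, ¬ IsBounded Ω
  holomorphic : ∀ Ω ∈ 𝒯, DifferentiableOn ℂ τ Ω
  bijOn : ∀ Ω ∈ 𝒯, BijOn τ Ω halfPlane
  tendsto_infty : ∀ Ω ∈ 𝒯,
    Tendsto (Function.invFunOn τ Ω) (cobounded ℂ ⊓ 𝓟 halfPlane) (cobounded ℂ)

/-- `f` is the model function `e ^ τ` of a tract model whose tracts have union `U`. -/
def IsModelFunction (f : ℂ → ℂ) (U : Set ℂ) : Prop :=
  ∃ (τ : ℂ → ℂ) (𝒯 : Set (Set ℂ)), IsTractModel τ 𝒯 ∧ U = ⋃₀ 𝒯 ∧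
    EqOn f (fun z => Complex.exp (τ z)) U

/-- The derivative `|f'(z)|₁ = |f'(z)| |z| / |f(z)|` of `f` with respect to the metric
`|dz| / |z|`. -/
noncomputable def cylDeriv (f : ℂ → ℂ) (z : ℂ) : ℝ := ‖deriv f z‖ * ‖z‖ / ‖f z‖

/-- The transfer operator `(L_t g)(w) = ∑_{f(z) = w} |f'(z)|₁ ^ (-t) g(z)` of `f : U → ℂ`, on
functions `g ≥ 0`; the value is `∞` if the series diverges. -/
noncomputable def transferOperator (f : ℂ → ℂ) (U : Set ℂ) (t : ℝ) (g : ℂ → ℝ≥0∞) (w : ℂ) :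
    ℝ≥0∞ :=
  ∑' z : {z : ℂ // z ∈ U ∧ f z = w}, ENNReal.ofReal (cylDeriv f z) ^ (-t) * g z

end LogTract

/-! Write w = exp ξ with Re ξ > 0. The fibre of f over w is parametrised by univalent functions φ_b
with f ∘ φ_b = exp, and L_t 1(exp ξ) = ∑_b |φ_b'(ξ)/φ_b(ξ)|^t. As φ_b omits 0, a Koebe estimate
gives |φ_b'/φ_b| ≤ 24 / Re ξ (`norm_logDeriv_le`). Bounded distortion (`norm_logDeriv_le_mul`)
carries finiteness at w₀ to a bound on a whole line Re ξ = r, since such a line is compact modulo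
2πi. Each |φ_b'/φ_b|^t is the modulus of a holomorphic function, so Phragmén–Lindelöf for finite
partial sums (`sum_norm_logDeriv_rpow_le`) keeps the same bound on Re ξ ≥ r.

For the decay, split off the power 1/p and bound it by (24 / log|w|)^(1/p). What remains is
L_{t-1/p} 1, which is bounded if t - 1/p > s. The condition 1/p < t/s - 1 gives this once s ≥ 1; and
s ≥ 1 because L_1 1(w₀) = ∞ as soon as there is a branch (`transferOperator_one_eq_top`): otherwise
the distinct preimages φ_b(ξ + 2πik) would converge as k → ∞.

For a model the branches are 2πi-translates of the tract inverses. For class B they come from path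
lifting, and a failure of injectivity would make φ_b periodic and f a polynomial. -/

namespace LogTract

/-! ### Koebe-type distortion estimates on the right half-plane -/

/-- A continuous solution `F` of `p (F z) = g z` is differentiable where `p' ≠ 0`. -/
lemma hasDerivAt_of_comp_eq {p g F : ℂ → ℂ} {a p' g' : ℂ} (hF : ContinuousAt F a)
    (hp : HasStrictDerivAt p p' (F a)) (hp' : p' ≠ 0) (hg : HasDerivAt g g' a)
    (h : ∀ᶠ z in 𝓝 a, p (F z) = g z) : HasDerivAt F (g' / p') a := by
  have h1 : ∀ᶠ z in 𝓝 a, hp.localInverse p p' (F a) hp' (p (F z)) = F z :=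
    hF.eventually (hp.eventually_left_inverse hp')
  have h2 : HasDerivAt (hp.localInverse p p' (F a) hp') p'⁻¹ (g a) := by
    rw [← h.self_of_nhds]
    exact (hp.to_localInverse hp').hasDerivAt
  have h3 := h2.comp a hg
  rw [div_eq_inv_mul]
  refine h3.congr_of_eventuallyEq ?_
  filter_upwards [h, h1] with z hz hz1
  rw [Function.comp_apply, ← hz, hz1]

lemma isOpen_halfPlane : IsOpen halfPlane := isOpen_lt continuous_const Complex.continuous_re

lemma convex_halfPlane : Convex ℝ halfPlane := convex_halfSpace_re_gt 0

lemma isSimplyConnected_halfPlane : IsSimplyConnected halfPlane := by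
  have : ContractibleSpace halfPlane :=
    convex_halfPlane.contractibleSpace ⟨1, by simp [halfPlane]⟩
  exact (inferInstance : SimplyConnectedSpace halfPlane)

lemma ball_subset_halfPlane (c : ℂ) : Metric.ball c c.re ⊆ halfPlane := by
  intro z hz
  rw [mem_ball_iff_norm'] at hz
  have := (le_abs_self _).trans (Complex.abs_re_le_norm (c - z))
  rw [Complex.sub_re] at this
  change 0 < z.re
  linarith

/-- A univalent function on the right half-plane. -/
structure IsUnivalent (φ : ℂ → ℂ) : Prop where
  differentiableOn : DifferentiableOn ℂ φ halfPlane
  injOn : InjOn φ halfPlane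
  deriv_ne_zero : ∀ z ∈ halfPlane, deriv φ z ≠ 0

namespace IsUnivalent

variable {φ : ℂ → ℂ} (hφ : IsUnivalent φ)
include hφ

lemma differentiableAt {z : ℂ} (hz : z ∈ halfPlane) : DifferentiableAt ℂ φ z :=
  hφ.differentiableOn.differentiableAt (isOpen_halfPlane.mem_nhds hz)

lemma hasStrictDerivAt {z : ℂ} (hz : z ∈ halfPlane) : HasStrictDerivAt φ (deriv φ z) z :=
  (hφ.differentiableOn.analyticAt (isOpen_halfPlane.mem_nhds hz)).hasStrictDerivAt

lemma image_mem_nhds {z : ℂ} (hz : z ∈ halfPlane) : φ '' halfPlane ∈ 𝓝 (φ z) := by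
  rw [← (hφ.hasStrictDerivAt hz).map_nhds_eq (hφ.deriv_ne_zero z hz)]
  exact image_mem_map (isOpen_halfPlane.mem_nhds hz)

lemma isOpen_image : IsOpen (φ '' halfPlane) := by
  rw [isOpen_iff_mem_nhds]
  rintro _ ⟨z, hz, rfl⟩
  exact hφ.image_mem_nhds hz

lemma invFunOn_apply {z : ℂ} (hz : z ∈ halfPlane) : Function.invFunOn φ halfPlane (φ z) = z :=
  hφ.injOn.leftInvOn_invFunOn hz

lemma hasDerivAt_invFunOn {z : ℂ} (hz : z ∈ halfPlane) :
    HasDerivAt (Function.invFunOn φ halfPlane) (deriv φ z)⁻¹ (φ z) := by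
  refine HasStrictDerivAt.hasDerivAt ?_
  refine (hφ.hasStrictDerivAt hz).to_local_left_inverse (hφ.deriv_ne_zero z hz) ?_
  filter_upwards [isOpen_halfPlane.mem_nhds hz] with x hx using hφ.invFunOn_apply hx

/-- The square root of the Koebe transform omits a disk. -/
lemma two_fifths_le_norm_add_one {a c : ℂ} (hc : c ∈ halfPlane) (ha : a ∉ φ '' halfPlane)
    (hball : Metric.ball (φ c) ‖a - φ c‖ ⊆ φ '' halfPlane) {h : ℂ → ℂ}
    (hh : ContinuousOn h halfPlane) (hc1 : h c = 1)
    (hsq : ∀ z, h z ^ 2 = (a - φ z) / (a - φ c)) {z : ℂ} (hz : z ∈ halfPlane) :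
    2 / 5 ≤ ‖h z + 1‖ := by
  have hac : a - φ c ≠ 0 := fun h0 => ha ⟨c, hc, (sub_eq_zero.1 h0).symm⟩
  have hne : ∀ z ∈ halfPlane, h z ≠ 0 := by
    intro z hz h0
    have := hsq z
    rw [h0, zero_pow two_ne_zero, eq_comm, div_eq_zero_iff, or_iff_left hac] at this
    exact ha ⟨z, hz, (sub_eq_zero.1 this).symm⟩
  -- On V, |1 - v²| = |v - 1||v + 1| ≤ (2/5)(12/5) < 1, so q maps V into the ball contained in the
  -- image. Then N = φ⁻¹ ∘ q is a local inverse of h on V.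
  set V : Set ℂ := Metric.ball 1 (2 / 5) with hV
  set q : ℂ → ℂ := fun v => φ c + (a - φ c) * (1 - v ^ 2) with hq
  set N : ℂ → ℂ := fun v => Function.invFunOn φ halfPlane (q v) with hN
  have hqV : ∀ v ∈ V, q v ∈ φ '' halfPlane := by
    intro v hv
    apply hball
    rw [mem_ball_iff_norm] at hv ⊢
    have e : q v - φ c = (a - φ c) * ((v - 1) * -(v + 1)) := by simp only [hq]; ring
    have h2 : ‖v + 1‖ ≤ 12 / 5 := by
      calc ‖v + 1‖ = ‖(v - 1) + 2‖ := by ring_nf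
        _ ≤ ‖v - 1‖ + ‖(2 : ℂ)‖ := norm_add_le _ _
        _ ≤ 12 / 5 := by rw [Complex.norm_ofNat]; linarith
    rw [e, norm_mul, norm_mul, norm_neg]
    refine mul_lt_of_lt_one_right (norm_pos_iff.2 hac) ?_
    nlinarith [norm_nonneg (v - 1), norm_nonneg (v + 1)]
  have hNV : ∀ v ∈ V, N v ∈ halfPlane := fun v hv => Function.invFunOn_mem (hqV v hv)
  have hφN : ∀ v ∈ V, φ (N v) = q v := fun v hv => Function.invFunOn_eq (hqV v hv)
  have hNc : ContinuousOn N V := by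
    intro v hv
    have h1 := (hφ.hasDerivAt_invFunOn (hNV v hv)).continuousAt
    rw [hφN v hv] at h1
    have h2 : ContinuousAt q v := by fun_prop
    exact (ContinuousAt.comp (g := Function.invFunOn φ halfPlane) h1 h2).continuousWithinAt
  have hN1 : N 1 = c := by
    simp only [hN, hq]
    simpa using hφ.invFunOn_apply hc
  have key : EqOn (h ∘ N) id V := by
    refine (convex_ball (1 : ℂ) (2 / 5)).isPreconnected.eq_of_sq_eq
      (hh.comp hNc hNV) continuousOn_id ?_ ?_ (y := 1) (by simp) (by simp [hN1, hc1])
    · intro v hv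
      simp only [Pi.pow_apply, Function.comp_apply, id]
      rw [hsq, hφN v hv, div_eq_iff hac]
      simp only [hq]; ring
    · rintro x hx rfl
      rw [mem_ball_iff_norm] at hx
      norm_num at hx
  -- The values v and -v cannot both be taken by h: they have the same square, so injectivity of φ
  -- would identify the two points.
  by_contra! hlt
  have hv : -h z ∈ V := by
    rwa [hV, mem_ball_iff_norm, ← norm_neg, show -(-h z - 1) = h z + 1 by ring]
  have h1 : h (N (-h z)) = -h z := key hv
  have h2 : N (-h z) = z := by
    refine hφ.injOn (hNV _ hv) hz ?_
    have e1 := hsq (N (-h z))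
    rw [h1, neg_sq, hsq z, div_left_inj' hac] at e1
    linear_combination e1
  rw [h2] at h1
  exact hne z hz (by linear_combination h1 / 2)

/-- A Koebe covering theorem with a non-sharp constant. -/
lemma norm_deriv_mul_re_le_of_ball_subset {a c : ℂ} (hc : c ∈ halfPlane)
    (ha : a ∉ φ '' halfPlane) (hball : Metric.ball (φ c) ‖a - φ c‖ ⊆ φ '' halfPlane) :
    ‖deriv φ c‖ * c.re ≤ 24 * ‖a - φ c‖ := by
  have hc0 : 0 < c.re := hc
  have hac : a - φ c ≠ 0 := fun h0 => ha ⟨c, hc, (sub_eq_zero.1 h0).symm⟩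
  have hg0 : (0 : ℂ) ∉ (fun z => (a - φ z) / (a - φ c)) '' halfPlane := by
    rintro ⟨z, hz, h0⟩
    rw [div_eq_zero_iff, or_iff_left hac] at h0
    exact ha ⟨z, hz, (sub_eq_zero.1 h0).symm⟩
  obtain ⟨h₀, h₀c, h₀sq⟩ := Complex.exists_continuousOn_pow_eq isSimplyConnected_halfPlane
    isOpen_halfPlane (g := fun z => (a - φ z) / (a - φ c))
    ((continuousOn_const.sub hφ.differentiableOn.continuousOn).div_const _) hg0 two_ne_zero
  -- Since h₀ c = ±1, this factor selects the root with h c = 1.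
  set h : ℂ → ℂ := fun z => h₀ z * h₀ c with hh
  have hcc : h₀ c ^ 2 = 1 := by rw [h₀sq, div_self hac]
  have hsq : ∀ z, h z ^ 2 = (a - φ z) / (a - φ c) := by
    intro z; rw [hh, mul_pow, hcc, h₀sq, mul_one]
  have hc1 : h c = 1 := by simp only [hh]; rw [← sq, hcc]
  have hcont : ContinuousOn h halfPlane := h₀c.mul continuousOn_const
  have hlow := fun z hz => hφ.two_fifths_le_norm_add_one hc ha hball hcont hc1 hsq (z := z) hz
  have hder : ∀ z ∈ halfPlane, HasDerivAt h (-deriv φ z / (a - φ c) / (2 * h z)) z := by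
    intro z hz
    refine hasDerivAt_of_comp_eq (p := fun w => w ^ 2) (g := fun z => (a - φ z) / (a - φ c))
      (hcont.continuousAt (isOpen_halfPlane.mem_nhds hz)) ?_ ?_ ?_ (Eventually.of_forall hsq)
    · simpa using hasStrictDerivAt_pow 2 (h z)
    · refine mul_ne_zero two_ne_zero fun h0 => hg0 ⟨z, hz, ?_⟩
      simp only
      rw [← hsq z, h0, zero_pow two_ne_zero]
    · exact ((hφ.differentiableAt hz).hasDerivAt.const_sub a).div_const _
  have hpos : ∀ z ∈ halfPlane, h z + 1 ≠ 0 := by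
    intro z hz h0
    have := hlow z hz
    rw [h0, norm_zero] at this
    norm_num at this
  have hu : ∀ z ∈ halfPlane, HasDerivAt (fun z => (h z + 1)⁻¹)
      (-(-deriv φ z / (a - φ c) / (2 * h z)) / (h z + 1) ^ 2) z := fun z hz =>
    ((hder z hz).add_const 1).inv (hpos z hz)
  have hnorm : ∀ z ∈ halfPlane, ‖(h z + 1)⁻¹‖ ≤ 5 / 2 := by
    intro z hz
    rw [norm_inv]
    exact (inv_anti₀ (by norm_num) (hlow z hz)).trans_eq (by norm_num)
  -- The function 1/(h + 1) is bounded by 5/2 and equals 1/2 at c, so it stays within 3 of its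
  -- central value. Its derivative at c has modulus |φ'(c)| / (8|a - φ(c)|), whence 24 = 3 · 8.
  have hS := Complex.norm_deriv_le_div_of_mapsTo_ball (f := fun z => (h z + 1)⁻¹) (c := c)
    (R₁ := c.re) (R₂ := 3)
    (fun z hz => (hu z (ball_subset_halfPlane c hz)).differentiableAt.differentiableWithinAt)
    (by
      intro z hz
      rw [mem_closedBall_iff_norm]
      refine (norm_sub_le _ _).trans ?_
      have := hnorm z (ball_subset_halfPlane c hz)
      rw [hc1]
      norm_num at this ⊢
      linarith) hc0
  rw [(hu c hc).deriv, hc1] at hS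
  have e : ‖-(-deriv φ c / (a - φ c) / (2 * 1)) / ((1 : ℂ) + 1) ^ 2‖
      = ‖deriv φ c‖ / (8 * ‖a - φ c‖) := by
    simp only [norm_div, norm_neg]
    norm_num
    field_simp
    ring
  rw [e, div_le_div_iff₀ (by positivity) hc0] at hS
  linarith

variable {K : Set ℂ}

/-- The point of the complement of the image nearest to φ c satisfies the ball hypothesis, and K is
no closer. Both K = {0} and K = the full complement are needed later. -/
lemma norm_deriv_mul_re_le_infDist {c : ℂ} (hc : c ∈ halfPlane) (hK : K.Nonempty)
    (hd : Disjoint K (φ '' halfPlane)) :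
    ‖deriv φ c‖ * c.re ≤ 24 * Metric.infDist (φ c) K := by
  have hsub : K ⊆ (φ '' halfPlane)ᶜ := hd.subset_compl_right
  obtain ⟨a, ha, hda⟩ := hφ.isOpen_image.isClosed_compl.exists_infDist_eq_dist (hK.mono hsub) (φ c)
  rw [dist_comm, dist_eq_norm] at hda
  refine (hφ.norm_deriv_mul_re_le_of_ball_subset hc ha ?_).trans ?_
  · rw [← hda]
    exact Metric.ball_infDist_compl_subset
  · rw [← hda]
    gcongr
    exact Metric.infDist_le_infDist_of_subset hsub hK

/-- Let M be the maximal distance to K over the small disk. Koebe bounds φ' there in terms of M, so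
φ moves by at most (24/49)M ≤ M/2 from its central value. Hence M is at most the central distance
plus M/2. -/
lemma infDist_le_two_mul {c z : ℂ} (hc : c ∈ halfPlane) (hK : K.Nonempty)
    (hd : Disjoint K (φ '' halfPlane)) (hz : ‖z - c‖ ≤ c.re / 50) :
    Metric.infDist (φ z) K ≤ 2 * Metric.infDist (φ c) K := by
  have hc0 : 0 < c.re := hc
  set B := Metric.closedBall c (c.re / 50) with hB
  have hBH : B ⊆ halfPlane :=
    (Metric.closedBall_subset_ball (by linarith)).trans (ball_subset_halfPlane c)
  have hcont : ContinuousOn (fun z => Metric.infDist (φ z) K) B :=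
    (Metric.continuous_infDist_pt K).comp_continuousOn (hφ.differentiableOn.continuousOn.mono hBH)
  obtain ⟨y, hy, hmax⟩ := (isCompact_closedBall c (c.re / 50)).exists_isMaxOn
    ⟨c, Metric.mem_closedBall_self (by positivity)⟩ hcont
  set M := Metric.infDist (φ y) K with hM
  have hM0 : 0 ≤ M := Metric.infDist_nonneg
  have hder : ∀ x ∈ B, ‖deriv φ x‖ ≤ 24 * M / (49 / 50 * c.re) := by
    intro x hx
    have h1 := hφ.norm_deriv_mul_re_le_infDist (hBH hx) hK hd
    have h2 : Metric.infDist (φ x) K ≤ M := hmax hx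
    have h3 : 49 / 50 * c.re ≤ x.re := by
      rw [hB, mem_closedBall_iff_norm'] at hx
      have := (le_abs_self _).trans (Complex.abs_re_le_norm (c - x))
      rw [Complex.sub_re] at this
      linarith
    rw [le_div_iff₀ (by positivity)]
    nlinarith [norm_nonneg (deriv φ x)]
  have hlip := (convex_closedBall c (c.re / 50)).norm_image_sub_le_of_norm_deriv_le
    (fun x hx => hφ.differentiableAt (hBH hx)) hder
    (Metric.mem_closedBall_self (by positivity)) hy
  have hyc : ‖y - c‖ ≤ c.re / 50 := mem_closedBall_iff_norm.1 hy
  have h4 : ‖φ y - φ c‖ ≤ M / 2 := by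
    refine hlip.trans ?_
    calc 24 * M / (49 / 50 * c.re) * ‖y - c‖ ≤ 24 * M / (49 / 50 * c.re) * (c.re / 50) := by gcongr
      _ = 24 / 49 * M := by field_simp
      _ ≤ M / 2 := by linarith
  have h5 : M ≤ Metric.infDist (φ c) K + dist (φ y) (φ c) := Metric.infDist_le_infDist_add_dist
  rw [dist_eq_norm] at h5
  have h6 : Metric.infDist (φ z) K ≤ M := hmax (mem_closedBall_iff_norm.2 hz)
  linarith

lemma infDist_le_two_pow_mul {m : ℝ} (hm : 0 < m) (hK : K.Nonempty)
    (hd : Disjoint K (φ '' halfPlane)) (N : ℕ) {c z : ℂ} (hc : m ≤ c.re) (hzm : m ≤ z.re)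
    (hz : ‖z - c‖ ≤ N * (m / 50)) :
    Metric.infDist (φ z) K ≤ 2 ^ N * Metric.infDist (φ c) K := by
  induction N generalizing z with
  | zero =>
    have : z = c := by simpa [sub_eq_zero] using hz
    simp [this]
  | succ N ih =>
    -- The last of N + 1 equal steps on the segment from c to z; each has length at most m/50, and
    -- the segment stays in Re ≥ m.
    set x : ℂ := c + ((N / (N + 1) : ℝ) : ℂ) * (z - c) with hx
    have h0 : (0 : ℝ) ≤ N / (N + 1) := by positivity
    have h1 : (N / (N + 1) : ℝ) ≤ 1 := by rw [div_le_one (by positivity)]; linarith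
    have hxre : m ≤ x.re := by
      have e : x.re = (1 - (N / (N + 1) : ℝ)) * c.re + (N / (N + 1) : ℝ) * z.re := by
        simp only [hx, Complex.add_re, Complex.re_ofReal_mul, Complex.sub_re]
        ring
      rw [e]
      nlinarith
    have hxc : ‖x - c‖ ≤ N * (m / 50) := by
      rw [hx, add_sub_cancel_left, norm_mul, Complex.norm_real, Real.norm_of_nonneg h0]
      push_cast at hz
      calc (N / (N + 1) : ℝ) * ‖z - c‖ ≤ (N / (N + 1) : ℝ) * ((N + 1) * (m / 50)) := by gcongr
        _ = N * (m / 50) := by field_simp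
    have hzx : ‖z - x‖ ≤ x.re / 50 := by
      have e : z - x = ((1 - N / (N + 1) : ℝ) : ℂ) * (z - c) := by rw [hx]; push_cast; ring
      have e2 : (1 - N / (N + 1) : ℝ) = 1 / (N + 1) := by field_simp; ring
      rw [e, norm_mul, Complex.norm_real, Real.norm_of_nonneg (by linarith), e2]
      push_cast at hz
      calc (1 / (N + 1) : ℝ) * ‖z - c‖ ≤ 1 / (N + 1) * ((N + 1) * (m / 50)) := by gcongr
        _ = m / 50 := by field_simp
        _ ≤ x.re / 50 := by linarith
    calc Metric.infDist (φ z) K ≤ 2 * Metric.infDist (φ x) K :=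
          hφ.infDist_le_two_mul (hm.trans_le hxre) hK hd hzx
      _ ≤ 2 * (2 ^ N * Metric.infDist (φ c) K) := by gcongr; exact ih hxre hxc
      _ = _ := by ring

/-- Converse to Koebe: Schwarz's lemma for φ⁻¹ followed by the Cayley map (ξ - c)/(ξ + c̄), on the
largest disk about φ c inside the image. -/
lemma infDist_compl_image_le {c : ℂ} (hc : c ∈ halfPlane) :
    Metric.infDist (φ c) (φ '' halfPlane)ᶜ ≤ 2 * c.re * ‖deriv φ c‖ := by
  have hc0 : 0 < c.re := hc
  set δ := Metric.infDist (φ c) (φ '' halfPlane)ᶜ with hδ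
  rcases (Metric.infDist_nonneg : 0 ≤ δ).eq_or_lt with h0 | h0
  · rw [hδ, ← h0]; positivity
  set G := Function.invFunOn φ halfPlane with hG
  have hball : Metric.ball (φ c) δ ⊆ φ '' halfPlane := Metric.ball_infDist_compl_subset
  have hGc : G (φ c) = c := hφ.invFunOn_apply hc
  have hden : ∀ ξ ∈ halfPlane, ξ + (starRingEnd ℂ) c ≠ 0 := by
    intro ξ hξ h
    have h1 : 0 < ξ.re := hξ
    have := congrArg Complex.re h
    simp only [Complex.add_re, Complex.conj_re, Complex.zero_re] at this
    linarith
  have hk : ∀ w ∈ φ '' halfPlane, HasDerivAt (fun w => (G w - c) / (G w + (starRingEnd ℂ) c))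
      (((deriv φ (G w))⁻¹ * (G w + (starRingEnd ℂ) c) - (G w - c) * (deriv φ (G w))⁻¹)
        / (G w + (starRingEnd ℂ) c) ^ 2) w := by
    rintro _ ⟨ξ, hξ, rfl⟩
    have h1 := hφ.hasDerivAt_invFunOn hξ
    rw [hG, hφ.invFunOn_apply hξ]
    have h2 := (h1.sub_const c).div (h1.add_const ((starRingEnd ℂ) c))
      (by rw [hφ.invFunOn_apply hξ]; exact hden ξ hξ)
    rwa [hφ.invFunOn_apply hξ] at h2
  have hS := Complex.norm_deriv_le_div_of_mapsTo_ball
    (f := fun w => (G w - c) / (G w + (starRingEnd ℂ) c)) (c := φ c) (R₁ := δ) (R₂ := 1)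
    (fun w hw => (hk w (hball hw)).differentiableAt.differentiableWithinAt)
    (by
      intro w hw
      obtain ⟨ξ, hξ, rfl⟩ := hball hw
      have h1 : 0 < ξ.re := hξ
      rw [mem_closedBall_iff_norm]
      simp only [hGc, sub_self, zero_div, sub_zero]
      rw [hG, hφ.invFunOn_apply hξ, norm_div, div_le_one (norm_pos_iff.2 (hden ξ hξ)),
        ← sq_le_sq₀ (norm_nonneg _) (norm_nonneg _), Complex.sq_norm, Complex.sq_norm,
        Complex.normSq_apply, Complex.normSq_apply]
      simp only [Complex.sub_re, Complex.sub_im, Complex.add_re, Complex.add_im,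
        Complex.conj_re, Complex.conj_im]
      nlinarith) h0
  rw [(hk _ ⟨c, hc, rfl⟩).deriv, hGc] at hS
  have hd0 := hφ.deriv_ne_zero c hc
  have e2 : c + (starRingEnd ℂ) c = ((2 * c.re : ℝ) : ℂ) := Complex.add_conj c
  have e : ((deriv φ c)⁻¹ * (c + (starRingEnd ℂ) c) - (c - c) * (deriv φ c)⁻¹)
      / (c + (starRingEnd ℂ) c) ^ 2 = (deriv φ c * ((2 * c.re : ℝ) : ℂ))⁻¹ := by
    have : ((2 * c.re : ℝ) : ℂ) ≠ 0 := by exact_mod_cast (by positivity : (2 * c.re : ℝ) ≠ 0)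
    rw [e2]
    field_simp
    ring
  rw [e, norm_inv, norm_mul, Complex.norm_real, Real.norm_of_nonneg (by positivity), inv_eq_one_div,
    div_le_div_iff₀ (mul_pos (norm_pos_iff.2 hd0) (by positivity)) h0] at hS
  linarith

variable (h0 : (0 : ℂ) ∉ φ '' halfPlane)
include h0

lemma norm_logDeriv_le {z : ℂ} (hz : z ∈ halfPlane) : ‖deriv φ z / φ z‖ ≤ 24 / z.re := by
  have h1 := hφ.norm_deriv_mul_re_le_infDist hz (singleton_nonempty (0 : ℂ))
    (by rwa [disjoint_singleton_left])
  rw [Metric.infDist_singleton, dist_zero_right] at h1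
  have h2 : φ z ≠ 0 := fun h => h0 ⟨z, hz, h⟩
  rw [norm_div, div_le_div_iff₀ (norm_pos_iff.2 h2) hz]
  exact h1

/-- Koebe at z, the chain of disks from z to c, and Schwarz at c, all with K the complement of the
image; 48 = 24 · 2. -/
lemma norm_deriv_le_mul {m : ℝ} (hm : 0 < m) (N : ℕ) {c z : ℂ} (hc : m ≤ c.re) (hzm : m ≤ z.re)
    (hz : ‖z - c‖ ≤ N * (m / 50)) :
    ‖deriv φ z‖ ≤ 48 * 2 ^ N * (c.re / m) * ‖deriv φ c‖ := by
  have hK : ((φ '' halfPlane)ᶜ).Nonempty := ⟨0, h0⟩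
  have h1 := hφ.norm_deriv_mul_re_le_infDist (c := z) (hm.trans_le hzm) hK disjoint_compl_left
  have h2 := hφ.infDist_le_two_pow_mul hm hK disjoint_compl_left N hc hzm hz
  have h3 := hφ.infDist_compl_image_le (c := c) (hm.trans_le hc)
  have h4 : ‖deriv φ z‖ * m ≤ 48 * 2 ^ N * c.re * ‖deriv φ c‖ := by
    calc ‖deriv φ z‖ * m ≤ ‖deriv φ z‖ * z.re := by gcongr
      _ ≤ 24 * (2 ^ N * (2 * c.re * ‖deriv φ c‖)) := by
        refine h1.trans ?_
        gcongr
        exact h2.trans (by gcongr)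
      _ = _ := by ring
  calc ‖deriv φ z‖ ≤ 48 * 2 ^ N * c.re * ‖deriv φ c‖ / m := by rwa [le_div_iff₀ hm]
    _ = _ := by ring

/-- The logarithmic derivative has bounded distortion. -/
lemma norm_logDeriv_le_mul {m : ℝ} (hm : 0 < m) (N : ℕ) {c z : ℂ} (hc : m ≤ c.re)
    (hzm : m ≤ z.re) (hz : ‖z - c‖ ≤ N * (m / 50)) :
    ‖deriv φ z / φ z‖ ≤ 48 * 2 ^ N * (c.re / m) * 2 ^ N * ‖deriv φ c / φ c‖ := by
  have h1 := hφ.norm_deriv_le_mul h0 hm N hc hzm hz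
  have h2 := hφ.infDist_le_two_pow_mul hm (singleton_nonempty (0 : ℂ))
    (by rwa [disjoint_singleton_left]) N hzm hc (by rwa [norm_sub_rev])
  simp only [Metric.infDist_singleton, dist_zero_right] at h2
  have hcpos : 0 < c.re := hm.trans_le hc
  have h3 : 0 < ‖φ z‖ := norm_pos_iff.2 fun h => h0 ⟨z, hm.trans_le hzm, h⟩
  have h4 : 0 < ‖φ c‖ := norm_pos_iff.2 fun h => h0 ⟨c, hcpos, h⟩
  rw [norm_div, norm_div, div_le_iff₀ h3]
  calc ‖deriv φ z‖ ≤ 48 * 2 ^ N * (c.re / m) * ‖deriv φ c‖ := h1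
    _ = 48 * 2 ^ N * (c.re / m) * (‖deriv φ c‖ / ‖φ c‖) * ‖φ c‖ := by field_simp
    _ ≤ 48 * 2 ^ N * (c.re / m) * (‖deriv φ c‖ / ‖φ c‖) * (2 ^ N * ‖φ z‖) := by gcongr
    _ = _ := by ring

end IsUnivalent

end LogTract

/-! ### The transfer operator as a sum over inverse branches -/

namespace LogTract

/-- A family of univalent functions on the right half-plane, parametrising for every `ξ` the fibre
of `f : U → ℂ` over `exp ξ`. -/
structure IsInverseBranchFamily {B : Type*} (f : ℂ → ℂ) (U : Set ℂ) (φ : B → ℂ → ℂ) : Prop where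
  univalent : ∀ b, IsUnivalent (φ b)
  bijOn : ∀ ξ ∈ halfPlane, BijOn (fun b => φ b ξ) univ {z | z ∈ U ∧ f z = Complex.exp ξ}
  differentiableAt : ∀ z ∈ U, DifferentiableAt ℂ f z
  not_tendsto : ∀ b, ∀ ξ ∈ halfPlane, ∀ a,
    ¬ Tendsto (fun k : ℕ => φ b (ξ + k * (2 * Real.pi * Complex.I))) atTop (𝓝 a)

/-- A discrete Grönwall argument: the product of the factors 1 + d k is at most exp ∑ d k, so x is
bounded and its increments are summable. -/
lemma exists_tendsto_of_norm_sub_le {x : ℕ → ℂ} {d : ℕ → ℝ} (hd : Summable d) (hd0 : ∀ k, 0 ≤ d k)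
    (h : ∀ k, ‖x (k + 1) - x k‖ ≤ d k * ‖x k‖) : ∃ a, Tendsto x atTop (𝓝 a) := by
  have h1 : ∀ k, ‖x k‖ ≤ ‖x 0‖ * Real.exp (∑ i ∈ Finset.range k, d i) := by
    intro k
    induction k with
    | zero => simp
    | succ k ih =>
      have e : x (k + 1) = x k + (x (k + 1) - x k) := by ring
      rw [e, Finset.sum_range_succ, Real.exp_add]
      calc ‖x k + (x (k + 1) - x k)‖ ≤ ‖x k‖ + d k * ‖x k‖ :=
            (norm_add_le _ _).trans (by gcongr; exact h k)
        _ = ‖x k‖ * (d k + 1) := by ring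
        _ ≤ ‖x 0‖ * Real.exp (∑ i ∈ Finset.range k, d i) * Real.exp (d k) :=
            mul_le_mul ih (Real.add_one_le_exp _) (by linarith [hd0 k]) (by positivity)
        _ = _ := by ring
  have h2 : ∀ k, ‖x k‖ ≤ ‖x 0‖ * Real.exp (∑' i, d i) := fun k =>
    (h1 k).trans (by gcongr; exact hd.sum_le_tsum _ fun i _ => hd0 i)
  refine cauchySeq_tendsto_of_complete (cauchySeq_of_summable_dist ?_)
  refine Summable.of_nonneg_of_le (fun _ => dist_nonneg) (fun k => ?_)
    (hd.mul_right (‖x 0‖ * Real.exp (∑' i, d i)))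
  rw [dist_comm, dist_eq_norm]
  exact (h k).trans (mul_le_mul_of_nonneg_left (h2 k) (hd0 k))

lemma add_mul_two_pi_I_mem_halfPlane {ξ : ℂ} (hξ : ξ ∈ halfPlane) (k : ℕ) :
    ξ + k * (2 * Real.pi * Complex.I) ∈ halfPlane := by
  change 0 < (ξ + k * (2 * Real.pi * Complex.I)).re
  simpa using (show 0 < ξ.re from hξ)

/-- If the logarithmic derivatives at the points `ξ + 2πik` are summable, the values at these
points converge. -/
lemma IsUnivalent.exists_tendsto_of_summable {φ : ℂ → ℂ} (hφ : IsUnivalent φ)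
    (h0 : (0 : ℂ) ∉ φ '' halfPlane) {ξ : ℂ} (hξ : ξ ∈ halfPlane)
    (hs : Summable fun k : ℕ => ‖deriv φ (ξ + k * (2 * Real.pi * Complex.I))
      / φ (ξ + k * (2 * Real.pi * Complex.I))‖) :
    ∃ a, Tendsto (fun k : ℕ => φ (ξ + k * (2 * Real.pi * Complex.I))) atTop (𝓝 a) := by
  have hm : 0 < ξ.re := hξ
  obtain ⟨N, hN⟩ := exists_nat_ge (2 * Real.pi / (ξ.re / 50))
  rw [div_le_iff₀ (by positivity)] at hN
  -- Mean value inequality on a vertical segment of length 2π, with φ' controlled by its value at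
  -- the lower end.
  set C : ℝ := 48 * 2 ^ N * (ξ.re / ξ.re) * (2 * Real.pi) with hC
  refine exists_tendsto_of_norm_sub_le (hs.mul_left C) (fun k => by positivity) fun k => ?_
  set c : ℂ := ξ + k * (2 * Real.pi * Complex.I) with hc
  have hcH : c ∈ halfPlane := add_mul_two_pi_I_mem_halfPlane hξ k
  have hcre : c.re = ξ.re := by simp [hc]
  have hc1 : ξ + (k + 1 : ℕ) * (2 * Real.pi * Complex.I) = c + 2 * Real.pi * Complex.I := by
    rw [hc]; push_cast; ring
  have hn : ‖(2 * Real.pi * Complex.I : ℂ)‖ = 2 * Real.pi := by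
    simp [abs_of_pos Real.pi_pos]
  rw [hc1]
  have hseg : ∀ x ∈ segment ℝ c (c + 2 * Real.pi * Complex.I),
      x.re = ξ.re ∧ ‖x - c‖ ≤ 2 * Real.pi := by
    intro x hx
    rw [segment_eq_image'] at hx
    obtain ⟨θ, ⟨h1, h2⟩, rfl⟩ := hx
    constructor
    · simp [hcre]
    · rw [add_sub_cancel_left, add_sub_cancel_left, norm_smul, hn, Real.norm_of_nonneg h1]
      exact mul_le_of_le_one_left (by positivity) h2
  have hlip := (convex_segment c (c + 2 * Real.pi * Complex.I)).norm_image_sub_le_of_norm_deriv_le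
    (f := φ) (C := 48 * 2 ^ N * (ξ.re / ξ.re) * ‖deriv φ c‖)
    (fun x hx => hφ.differentiableAt (show 0 < x.re by rw [(hseg x hx).1]; exact hm))
    (fun x hx => by
      have := hφ.norm_deriv_le_mul h0 hm N (c := c) (z := x) hcre.ge (hseg x hx).1.ge
        ((hseg x hx).2.trans hN)
      rwa [hcre] at this)
    (left_mem_segment _ _ _) (right_mem_segment _ _ _)
  rw [add_sub_cancel_left, hn] at hlip
  have h4 : 0 < ‖φ c‖ := norm_pos_iff.2 fun h => h0 ⟨c, hcH, h⟩
  refine hlip.trans_eq ?_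
  rw [norm_div, mul_assoc C, div_mul_cancel₀ _ h4.ne', hC]
  ring

/-- Phragmén–Lindelöf for finite sums of powers of logarithmic derivatives. -/
lemma sum_norm_logDeriv_rpow_le {B : Type*} {φ : B → ℂ → ℂ} (hφ : ∀ b, IsUnivalent (φ b))
    (h0 : ∀ b, (0 : ℂ) ∉ φ b '' halfPlane) (F : Finset B) {t r M : ℝ} (ht : 0 < t) (hr : 0 < r)
    (hM : ∀ ξ : ℂ, ξ.re = r → ∑ b ∈ F, ‖deriv (φ b) ξ / φ b ξ‖ ^ t ≤ M) {ξ : ℂ} (hξ : r ≤ ξ.re) :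
    ∑ b ∈ F, ‖deriv (φ b) ξ / φ b ξ‖ ^ t ≤ M := by
  have hne : ∀ b, ∀ z ∈ halfPlane, φ b z ≠ 0 := fun b z hz h => h0 b ⟨z, hz, h⟩
  have hdd : ∀ b, DifferentiableOn ℂ (fun z => deriv (φ b) z / φ b z) halfPlane := fun b =>
    ((hφ b).differentiableOn.deriv isOpen_halfPlane).div (hφ b).differentiableOn (hne b)
  have hlog : ∀ b, ∃ g : ℂ → ℂ, DifferentiableOn ℂ g halfPlane ∧
      ∀ z ∈ halfPlane, Complex.exp (g z) = deriv (φ b) z / φ b z := by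
    intro b
    obtain ⟨g, hgc, hg⟩ := Complex.exists_continuousOn_eqOn_exp_comp isSimplyConnected_halfPlane
      isOpen_halfPlane (hdd b).continuousOn (by
        rintro ⟨z, hz, h⟩
        exact div_ne_zero ((hφ b).deriv_ne_zero z hz) (hne b z hz) h)
    refine ⟨g, fun z hz => ?_, hg⟩
    have hn := isOpen_halfPlane.mem_nhds hz
    exact (hasDerivAt_of_comp_eq (hgc.continuousAt hn) (Complex.hasStrictDerivAt_exp _)
      (Complex.exp_ne_zero _) ((hdd b).differentiableAt hn).hasDerivAt
      (by filter_upwards [hn] with x hx using hg hx)).differentiableAt.differentiableWithinAt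
  choose g hgd hg using hlog
  -- With g b a logarithm of φ_b'/φ_b, the sum is the ℓ¹ norm of this holomorphic vector, so the
  -- maximum principle applies to it directly.
  set h : ℂ → PiLp 1 (fun _ : F => ℂ) := fun ζ =>
    WithLp.toLp 1 fun b => Complex.exp (t * g b (ζ + r)) with hh
  have hshift : ∀ ζ : ℂ, 0 ≤ ζ.re → ζ + r ∈ halfPlane := by
    intro ζ hζ
    change 0 < (ζ + r).re
    simp only [Complex.add_re, Complex.ofReal_re]
    linarith
  have hnorm : ∀ ζ : ℂ, 0 ≤ ζ.re →
      ‖h ζ‖ = ∑ b ∈ F, ‖deriv (φ b) (ζ + r) / φ b (ζ + r)‖ ^ t := by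
    intro ζ hζ
    rw [hh, PiLp.norm_eq_of_L1, ← Finset.sum_coe_sort F]
    refine Finset.sum_congr rfl fun b _ => ?_
    simp only
    rw [← hg b _ (hshift ζ hζ), Complex.norm_exp, Complex.norm_exp, ← Real.exp_mul,
      Complex.re_ofReal_mul, mul_comm]
  have hbound : ∀ ζ : ℂ, 0 ≤ ζ.re → ‖h ζ‖ ≤ F.card • (24 / r) ^ t := by
    intro ζ hζ
    rw [hnorm ζ hζ]
    refine Finset.sum_le_card_nsmul _ _ _ fun b _ => ?_
    refine Real.rpow_le_rpow (norm_nonneg _) (((hφ b).norm_logDeriv_le (h0 b)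
      (hshift ζ hζ)).trans ?_) ht.le
    gcongr
    simp only [Complex.add_re, Complex.ofReal_re]
    linarith
  have hd : DifferentiableOn ℂ h {z | 0 ≤ z.re} := by
    refine (PiLp.continuousLinearEquiv 1 ℂ (fun _ : F => ℂ)).symm.differentiable.comp_differentiableOn ?_
    refine differentiableOn_pi.2 fun b => ?_
    have : DifferentiableOn ℂ (fun ζ : ℂ => g b (ζ + r)) {z | 0 ≤ z.re} :=
      (hgd b).comp (by fun_prop) hshift
    exact (this.const_mul _).cexp
  -- The a priori bound card F · (24/r)^t only excludes growth. It depends on F, whereas the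
  -- resulting bound M does not.
  have key := PhragmenLindelof.right_half_plane_of_bounded_on_real (f := h) (C := M) (z := ξ - r)
    (DifferentiableOn.diffContOnCl (by rwa [Complex.closure_setOfPred_lt_re]))
    ⟨0, by norm_num, 0, by
      refine Asymptotics.IsBigO.of_bound (F.card • (24 / r) ^ t) ?_
      refine eventually_inf_principal.2 <| Eventually.of_forall fun z hz => ?_
      simpa using hbound z (le_of_lt hz)⟩
    ⟨F.card • (24 / r) ^ t, by
      rw [eventually_map]
      filter_upwards [eventually_ge_atTop 0] with x hx
      exact hbound x (by simpa using hx)⟩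
    (fun x => by
      rw [hnorm _ (by simp)]
      exact hM _ (by simp))
    (by simpa using hξ)
  rwa [hnorm _ (by simpa using hξ), sub_add_cancel] at key

namespace IsInverseBranchFamily

variable {B : Type*} {f : ℂ → ℂ} {U : Set ℂ} {φ : B → ℂ → ℂ} (hφ : IsInverseBranchFamily f U φ)
  (h0 : (0 : ℂ) ∉ U)
include hφ

lemma mem {b : B} {ξ : ℂ} (hξ : ξ ∈ halfPlane) : φ b ξ ∈ U ∧ f (φ b ξ) = Complex.exp ξ :=
  (hφ.bijOn ξ hξ).mapsTo (mem_univ b)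

lemma cylDeriv_eq (b : B) {ξ : ℂ} (hξ : ξ ∈ halfPlane) :
    cylDeriv f (φ b ξ) = ‖deriv (φ b) ξ / φ b ξ‖⁻¹ := by
  have h1 : HasDerivAt (fun z => f (φ b z)) (deriv f (φ b ξ) * deriv (φ b) ξ) ξ :=
    (hφ.differentiableAt _ (hφ.mem hξ).1).hasDerivAt.comp ξ
      ((hφ.univalent b).differentiableAt hξ).hasDerivAt
  have h2 : HasDerivAt (fun z => f (φ b z)) (Complex.exp ξ) ξ := by
    refine (Complex.hasDerivAt_exp ξ).congr_of_eventuallyEq ?_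
    filter_upwards [isOpen_halfPlane.mem_nhds hξ] with z hz using (hφ.mem hz).2
  have h3 := h1.unique h2
  have hd := (hφ.univalent b).deriv_ne_zero ξ hξ
  have hn := norm_pos_iff.2 hd
  have h4 : ‖deriv f (φ b ξ)‖ = ‖Complex.exp ξ‖ / ‖deriv (φ b) ξ‖ := by
    rw [← h3, norm_mul, mul_div_cancel_right₀ _ hn.ne']
  rw [cylDeriv, (hφ.mem hξ).2, h4, norm_div, inv_div]
  have := norm_pos_iff.2 (Complex.exp_ne_zero ξ)
  field_simp

include h0

lemma zero_notMem (b : B) : (0 : ℂ) ∉ φ b '' halfPlane := by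
  rintro ⟨ξ, hξ, h⟩
  exact h0 (h ▸ (hφ.mem hξ).1)

lemma norm_logDeriv_pos (b : B) {ξ : ℂ} (hξ : ξ ∈ halfPlane) : 0 < ‖deriv (φ b) ξ / φ b ξ‖ :=
  norm_pos_iff.2 (div_ne_zero ((hφ.univalent b).deriv_ne_zero ξ hξ)
    fun h => hφ.zero_notMem h0 b ⟨ξ, hξ, h⟩)

lemma cylDeriv_rpow_eq (b : B) {ξ : ℂ} (hξ : ξ ∈ halfPlane) (t : ℝ) :
    ENNReal.ofReal (cylDeriv f (φ b ξ)) ^ (-t)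
      = ENNReal.ofReal (‖deriv (φ b) ξ / φ b ξ‖ ^ t) := by
  have := hφ.norm_logDeriv_pos h0 b hξ
  rw [hφ.cylDeriv_eq b hξ, ENNReal.ofReal_inv_of_pos this, ENNReal.inv_rpow, ENNReal.rpow_neg,
    inv_inv, ENNReal.ofReal_rpow_of_pos this]

/-- The index set B is independent of ξ, so the fibre sum becomes a series of functions of ξ. -/
lemma transferOperator_eq {ξ : ℂ} (hξ : ξ ∈ halfPlane) (t : ℝ) :
    transferOperator f U t 1 (Complex.exp ξ)
      = ∑' b, ENNReal.ofReal (‖deriv (φ b) ξ / φ b ξ‖ ^ t) := by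
  have hb := hφ.bijOn ξ hξ
  let e : B ≃ {z : ℂ // z ∈ U ∧ f z = Complex.exp ξ} :=
    Equiv.ofBijective (fun b => ⟨φ b ξ, hφ.mem hξ⟩)
      ⟨fun b b' h => hb.injOn (mem_univ b) (mem_univ b') (congrArg Subtype.val h),
        fun z => by
          obtain ⟨b, -, h⟩ := hb.surjOn z.2
          exact ⟨b, Subtype.ext h⟩⟩
  rw [transferOperator, ← e.tsum_eq]
  refine tsum_congr fun b => ?_
  simp only [Pi.one_apply, mul_one]
  exact hφ.cylDeriv_rpow_eq h0 b hξ t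

lemma transferOperator_exp_le {m : ℝ} (hm : 0 < m) (N : ℕ) {c z : ℂ} (hc : m ≤ c.re)
    (hzm : m ≤ z.re) (hz : ‖z - c‖ ≤ N * (m / 50)) {t : ℝ} (ht : 0 < t) :
    transferOperator f U t 1 (Complex.exp z) ≤
      ENNReal.ofReal ((48 * 2 ^ N * (c.re / m) * 2 ^ N) ^ t)
        * transferOperator f U t 1 (Complex.exp c) := by
  have hcp : 0 < c.re := hm.trans_le hc
  rw [hφ.transferOperator_eq h0 (hm.trans_le hc), hφ.transferOperator_eq h0 (hm.trans_le hzm),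
    ← ENNReal.tsum_mul_left]
  refine ENNReal.tsum_le_tsum fun b => ?_
  rw [← ENNReal.ofReal_mul (by positivity), ← Real.mul_rpow (by positivity) (norm_nonneg _)]
  exact ENNReal.ofReal_le_ofReal (Real.rpow_le_rpow (norm_nonneg _)
    ((hφ.univalent b).norm_logDeriv_le_mul (hφ.zero_notMem h0 b) hm N hc hzm hz) ht.le)

/-- Modulo 2πi the line Re ξ = r lies within bounded distance of log w₀, so one distortion constant
serves every point of it. -/
lemma exists_bound_of_re_eq {w₀ : ℂ} (hw₀ : 1 < ‖w₀‖) {t r : ℝ} (ht : 0 < t) (hr : 0 < r)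
    (hfin : transferOperator f U t 1 w₀ < ∞) :
    ∃ M : NNReal, ∀ ξ : ℂ, ξ.re = r → transferOperator f U t 1 (Complex.exp ξ) ≤ M := by
  have hw : w₀ ≠ 0 := by rintro rfl; norm_num at hw₀
  have hl : 0 < Real.log ‖w₀‖ := Real.log_pos hw₀
  set c := Complex.log w₀ with hc
  have hcre : c.re = Real.log ‖w₀‖ := Complex.log_re w₀
  set m := min r (Real.log ‖w₀‖) with hm
  have hm0 : 0 < m := lt_min hr hl
  obtain ⟨N, hN⟩ := exists_nat_ge ((r + Real.log ‖w₀‖ + 2 * Real.pi) / (m / 50))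
  rw [div_le_iff₀ (by positivity)] at hN
  set K := ENNReal.ofReal ((48 * 2 ^ N * (c.re / m) * 2 ^ N) ^ t) * transferOperator f U t 1 w₀
    with hK
  have hKtop : K < ∞ := ENNReal.mul_lt_top ENNReal.ofReal_lt_top hfin
  refine ⟨K.toNNReal, fun ξ hξ => ?_⟩
  rw [ENNReal.coe_toNNReal hKtop.ne, ← Complex.exp_log (Complex.exp_ne_zero ξ)]
  set z := Complex.log (Complex.exp ξ) with hz
  have hzre : z.re = r := by rw [hz, Complex.log_re, Complex.norm_exp, Real.log_exp, hξ]
  have hzc : ‖z - c‖ ≤ N * (m / 50) := by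
    refine (Complex.norm_le_abs_re_add_abs_im _).trans (le_trans ?_ hN)
    rw [Complex.sub_re, Complex.sub_im, hzre, hcre]
    have h1 : |r - Real.log ‖w₀‖| ≤ r + Real.log ‖w₀‖ := by
      rw [abs_le]; constructor <;> linarith
    have h2 : |z.im - c.im| ≤ 2 * Real.pi := by
      rw [abs_le, hz, hc]
      constructor <;> linarith [Complex.neg_pi_lt_log_im w₀, Complex.log_im_le_pi w₀,
        Complex.neg_pi_lt_log_im (Complex.exp ξ), Complex.log_im_le_pi (Complex.exp ξ)]
    linarith
  have := hφ.transferOperator_exp_le h0 hm0 N (c := c) (z := z) (by rw [hcre]; exact min_le_right _ _)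
    (by rw [hzre]; exact min_le_left _ _) hzc ht
  rwa [hc, Complex.exp_log hw] at this

lemma exists_bound {w₀ : ℂ} (hw₀ : 1 < ‖w₀‖) {t r : ℝ} (ht : 0 < t) (hr : 0 < r)
    (hfin : transferOperator f U t 1 w₀ < ∞) :
    ∃ M : NNReal, ∀ ξ : ℂ, r ≤ ξ.re → transferOperator f U t 1 (Complex.exp ξ) ≤ M := by
  obtain ⟨M, hM⟩ := hφ.exists_bound_of_re_eq h0 hw₀ ht hr hfin
  refine ⟨M, fun ξ hξ => ?_⟩
  rw [hφ.transferOperator_eq h0 (show 0 < ξ.re from hr.trans_le hξ), ENNReal.tsum_eq_iSup_sum]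
  have hiff : ∀ (F : Finset B) (z : ℂ),
      ∑ b ∈ F, ENNReal.ofReal (‖deriv (φ b) z / φ b z‖ ^ t) ≤ M ↔
        ∑ b ∈ F, ‖deriv (φ b) z / φ b z‖ ^ t ≤ M := by
    intro F z
    rw [← ENNReal.ofReal_sum_of_nonneg fun b _ => by positivity]
    exact ENNReal.ofReal_le_coe
  refine iSup_le fun F => (hiff F ξ).2 ?_
  refine sum_norm_logDeriv_rpow_le hφ.univalent (hφ.zero_notMem h0) F ht hr (fun z hz => ?_) hξ
  refine (hiff F z).1 ((ENNReal.sum_le_tsum F).trans ?_)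
  rw [← hφ.transferOperator_eq h0 (show 0 < z.re from hz ▸ hr)]
  exact hM z hz

/-- The points φ_b(ξ + 2πik) are distinct preimages of w₀. Were their terms summable for t = 1, they
would converge, contrary to `not_tendsto`. -/
lemma transferOperator_one_eq_top (b : B) {w₀ : ℂ} (hw₀ : 1 < ‖w₀‖) :
    transferOperator f U 1 1 w₀ = ∞ := by
  by_contra htop
  have hw : w₀ ≠ 0 := by rintro rfl; norm_num at hw₀
  set ξ := Complex.log w₀ with hξ
  have hξH : ξ ∈ halfPlane := by
    change 0 < ξ.re
    rw [hξ, Complex.log_re]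
    exact Real.log_pos hw₀
  have hk := add_mul_two_pi_I_mem_halfPlane hξH
  have hexp : ∀ k : ℕ, Complex.exp (ξ + k * (2 * Real.pi * Complex.I)) = w₀ := by
    intro k
    rw [Complex.exp_add, Complex.exp_nat_mul_two_pi_mul_I, mul_one, hξ, Complex.exp_log hw]
  let i : ℕ → {z : ℂ // z ∈ U ∧ f z = w₀} := fun k =>
    ⟨φ b (ξ + k * (2 * Real.pi * Complex.I)), (hφ.mem (hk k)).1,
      (hφ.mem (hk k)).2.trans (hexp k)⟩
  have hi : Function.Injective i := by
    intro k l hkl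
    have h1 := (hφ.univalent b).injOn (hk k) (hk l) (congrArg Subtype.val hkl)
    have h2 := mul_right_cancel₀ Complex.two_pi_I_ne_zero (add_left_cancel h1)
    exact_mod_cast h2
  have h1 := ENNReal.tsum_comp_le_tsum_of_injective hi
    fun z => ENNReal.ofReal (cylDeriv f z) ^ (-1 : ℝ) * (1 : ℂ → ℝ≥0∞) z
  have h2 : ∀ k, ENNReal.ofReal (cylDeriv f (i k)) ^ (-1 : ℝ) * (1 : ℂ → ℝ≥0∞) (i k)
      = ENNReal.ofReal ‖deriv (φ b) (ξ + k * (2 * Real.pi * Complex.I))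
      / φ b (ξ + k * (2 * Real.pi * Complex.I))‖ := by
    intro k
    rw [Pi.one_apply, mul_one, hφ.cylDeriv_rpow_eq h0 b (hk k), Real.rpow_one]
  simp only [h2] at h1
  have h3 := ENNReal.summable_toReal (ne_top_of_le_ne_top htop h1)
  simp only [ENNReal.toReal_ofReal (norm_nonneg _)] at h3
  obtain ⟨a, ha⟩ := (hφ.univalent b).exists_tendsto_of_summable (hφ.zero_notMem h0 b) hξH h3
  exact hφ.not_tendsto b ξ hξH a ha

/-- Boundedness and decay of the transfer operator. -/
theorem transferOperator_bounds {s : ℝ} (hs : 0 < s) {w₀ : ℂ} (hw₀ : 1 < ‖w₀‖)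
    (hfin : ∀ t : ℝ, s < t → transferOperator f U t 1 w₀ < ∞) {γ : ℝ} (hγ : 0 < γ) :
    (∀ t : ℝ, s < t →
      ∃ M : NNReal, ∀ w : ℂ, Real.exp γ < ‖w‖ → transferOperator f U t 1 w ≤ M) ∧
    (∀ t p : ℝ, s < t → 1 < p → 1 / p < t / s - 1 →
      ∃ C : ℝ, ∀ w : ℂ, Real.exp γ < ‖w‖ →
        transferOperator f U t 1 w ≤ ENNReal.ofReal (C / (Real.log ‖w‖) ^ (1 / p))) := by
  have hlog : ∀ w : ℂ, Real.exp γ < ‖w‖ →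
      Complex.exp (Complex.log w) = w ∧ γ < (Complex.log w).re := by
    intro w hw
    have hw0 : 0 < ‖w‖ := (Real.exp_pos γ).trans hw
    exact ⟨Complex.exp_log (norm_pos_iff.1 hw0), by
      rw [Complex.log_re]; exact (Real.lt_log_iff_exp_lt hw0).2 hw⟩
  have hb : ∀ t : ℝ, s < t →
      ∃ M : NNReal, ∀ w : ℂ, Real.exp γ < ‖w‖ → transferOperator f U t 1 w ≤ M := by
    intro t ht
    obtain ⟨M, hM⟩ := hφ.exists_bound h0 hw₀ (hs.trans ht) hγ (hfin t ht)
    refine ⟨M, fun w hw => ?_⟩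
    obtain ⟨h1, h2⟩ := hlog w hw
    rw [← h1]
    exact hM _ h2.le
  refine ⟨hb, fun t p ht hp hpt => ?_⟩
  have hp0 : 0 < 1 / p := by positivity
  -- Without branches the operator vanishes, and s ≥ 1 may fail.
  rcases isEmpty_or_nonempty B with hB | ⟨⟨b⟩⟩
  · refine ⟨0, fun w hw => ?_⟩
    obtain ⟨h1, h2⟩ := hlog w hw
    rw [← h1, hφ.transferOperator_eq h0 (show 0 < (Complex.log w).re from hγ.trans h2)]
    simp
  have hs1 : 1 ≤ s := by
    by_contra! h
    exact (hfin 1 h).ne (hφ.transferOperator_one_eq_top h0 b hw₀)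
  -- Here s ≥ 1 enters: t/s - 1 = (t - s)/s ≤ t - s.
  have hq : s < t - 1 / p := by
    have : t / s - 1 ≤ t - s := by
      rw [div_sub_one hs.ne', div_le_iff₀ hs]
      nlinarith
    linarith
  obtain ⟨M, hM⟩ := hb _ hq
  refine ⟨24 ^ (1 / p) * M, fun w hw => ?_⟩
  obtain ⟨h1, h2⟩ := hlog w hw
  have hξ : Complex.log w ∈ halfPlane := hγ.trans h2
  have hlpos : 0 < Real.log ‖w‖ := by
    have := hγ.trans h2
    rwa [Complex.log_re] at this
  have hMw := hM w hw
  have e : 24 ^ (1 / p) * (M : ℝ) / Real.log ‖w‖ ^ (1 / p)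
      = (24 / Real.log ‖w‖) ^ (1 / p) * M := by
    rw [Real.div_rpow (by norm_num) hlpos.le]; ring
  have hnn : 0 ≤ (24 / Real.log ‖w‖) ^ (1 / p) :=
    Real.rpow_nonneg (div_nonneg (by norm_num) hlpos.le) _
  rw [e, ENNReal.ofReal_mul hnn, ENNReal.ofReal_coe_nnreal]
  refine le_trans ?_ (mul_le_mul_right hMw _)
  rw [← h1, hφ.transferOperator_eq h0 hξ, hφ.transferOperator_eq h0 hξ, ← ENNReal.tsum_mul_left]
  refine ENNReal.tsum_le_tsum fun b => ?_
  rw [h1, ← ENNReal.ofReal_mul hnn]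
  refine ENNReal.ofReal_le_ofReal ?_
  have hpos := hφ.norm_logDeriv_pos h0 b hξ
  have h3 := (hφ.univalent b).norm_logDeriv_le (hφ.zero_notMem h0 b) hξ
  rw [Complex.log_re] at h3
  calc ‖deriv (φ b) (Complex.log w) / φ b (Complex.log w)‖ ^ t
      = ‖deriv (φ b) (Complex.log w) / φ b (Complex.log w)‖ ^ (1 / p)
        * ‖deriv (φ b) (Complex.log w) / φ b (Complex.log w)‖ ^ (t - 1 / p) := by
        rw [← Real.rpow_add hpos]; congr 1; ring
    _ ≤ _ := by gcongr

end IsInverseBranchFamily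

end LogTract

/-! ### Inverse branches of model functions -/

namespace LogTract

section Injective

variable {g : ℂ → ℂ} {S : Set ℂ} (hS : IsOpen S) (hg : DifferentiableOn ℂ g S) (hinj : InjOn g S)
include hS hg hinj

/-- The open mapping theorem: an injective function is not locally constant. -/
lemma nhds_le_map_nhds_of_injOn {z : ℂ} (hz : z ∈ S) : 𝓝 (g z) ≤ map g (𝓝 z) := by
  refine (hg.analyticAt (hS.mem_nhds hz)).eventually_constant_or_nhds_le_map_nhds.resolve_left
    fun h => ?_
  have h1 : ∀ᶠ x in 𝓝[≠] z, g x = g z ∧ x ∈ S :=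
    (h.and (hS.mem_nhds hz)).filter_mono nhdsWithin_le_nhds
  obtain ⟨x, ⟨hx, hxS⟩, hxz⟩ := (h1.and self_mem_nhdsWithin).exists
  exact hxz (hinj hxS hz hx)

lemma continuousAt_invFunOn {z : ℂ} (hz : z ∈ S) : ContinuousAt (Function.invFunOn g S) (g z) := by
  rw [ContinuousAt, hinj.leftInvOn_invFunOn hz]
  refine (tendsto_map' ?_).mono_left (nhds_le_map_nhds_of_injOn hS hg hinj hz)
  refine tendsto_id.congr' ?_
  filter_upwards [hS.mem_nhds hz] with x hx using (hinj.leftInvOn_invFunOn hx).symm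

lemma hasDerivAt_invFunOn_of_deriv_ne_zero {z : ℂ} (hz : z ∈ S) (hd : deriv g z ≠ 0) :
    HasDerivAt (Function.invFunOn g S) (deriv g z)⁻¹ (g z) := by
  refine HasStrictDerivAt.hasDerivAt ?_
  refine (hg.analyticAt (hS.mem_nhds hz)).hasStrictDerivAt.to_local_left_inverse hd ?_
  filter_upwards [hS.mem_nhds hz] with x hx using hinj.leftInvOn_invFunOn hx

/-- The derivative of an injective holomorphic function does not vanish. -/
lemma deriv_ne_zero_of_injOn {z : ℂ} (hz : z ∈ S) : deriv g z ≠ 0 := by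
  have hSz := hS.mem_nhds hz
  have hne : ∀ᶠ x in 𝓝[≠] z, deriv g x ≠ 0 := by
    refine (hg.analyticAt hSz).deriv.eventually_eq_zero_or_eventually_ne_zero.resolve_left
      fun h => ?_
    obtain ⟨ε, hε, hball⟩ := Metric.eventually_nhds_iff_ball.1 (h.and hSz)
    have hlip : ∀ x ∈ Metric.ball z ε, g x = g z := by
      intro x hx
      have := (convex_ball z ε).norm_image_sub_le_of_norm_deriv_le (f := g) (C := 0)
        (fun y hy => hg.differentiableAt (hS.mem_nhds (hball y hy).2))
        (fun y hy => by rw [(hball y hy).1, norm_zero]) (Metric.mem_ball_self hε) hx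
      rw [zero_mul, norm_le_zero_iff, sub_eq_zero] at this
      exact this
    have h1 : ∀ᶠ x in 𝓝[≠] z, x ∈ Metric.ball z ε :=
      nhdsWithin_le_nhds (Metric.ball_mem_nhds z hε)
    obtain ⟨x, hx, hxz⟩ := (h1.and self_mem_nhdsWithin).exists
    exact hxz (hinj (hball x hx).2 hz (hlip x hx))
  -- The inverse is holomorphic off g z and continuous there, so the singularity is removable; the
  -- chain rule for the identity then excludes g' z = 0.
  have hdiff : ∀ᶠ w in 𝓝[≠] g z, DifferentiableAt ℂ (Function.invFunOn g S) w := by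
    rw [eventually_nhdsWithin_iff] at hne ⊢
    refine nhds_le_map_nhds_of_injOn hS hg hinj hz ?_
    rw [mem_map]
    filter_upwards [hne, hSz] with x hx hxS hxz
    exact (hasDerivAt_invFunOn_of_deriv_ne_zero hS hg hinj hxS
      (hx fun h => hxz (congrArg g h))).differentiableAt
  have hG : DifferentiableAt ℂ (Function.invFunOn g S) (g z) :=
    (Complex.analyticAt_of_differentiable_on_punctured_nhds_of_continuousAt hdiff
      (continuousAt_invFunOn hS hg hinj hz)).differentiableAt
  have h1 := hG.hasDerivAt.comp z (hg.differentiableAt hSz).hasDerivAt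
  have h2 : HasDerivAt (Function.invFunOn g S ∘ g) 1 z := by
    refine (hasDerivAt_id z).congr_of_eventuallyEq ?_
    filter_upwards [hSz] with x hx using hinj.leftInvOn_invFunOn hx
  intro h0
  rw [h0, mul_zero] at h1
  exact one_ne_zero (h2.unique h1)

end Injective

lemma IsUnivalent.comp_add {φ : ℂ → ℂ} (hφ : IsUnivalent φ) {a : ℂ} (ha : a.re = 0) :
    IsUnivalent fun z => φ (z + a) := by
  have hmem : ∀ z ∈ halfPlane, z + a ∈ halfPlane := by
    intro z hz
    change 0 < (z + a).re
    rw [Complex.add_re, ha, add_zero]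
    exact hz
  refine ⟨hφ.differentiableOn.comp (by fun_prop) hmem, fun z hz z' hz' h =>
    add_right_cancel (hφ.injOn (hmem z hz) (hmem z' hz') h), fun z hz => ?_⟩
  rw [deriv_comp_add_const]
  exact hφ.deriv_ne_zero _ (hmem z hz)

namespace IsTractModel

variable {τ : ℂ → ℂ} {𝒯 : Set (Set ℂ)} (hτ : IsTractModel τ 𝒯)
include hτ

lemma invFunOn_mem {Ω : Set ℂ} (hΩ : Ω ∈ 𝒯) {ξ : ℂ} (hξ : ξ ∈ halfPlane) :
    Function.invFunOn τ Ω ξ ∈ Ω :=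
  Function.invFunOn_mem ((hτ.bijOn Ω hΩ).surjOn hξ)

lemma apply_invFunOn {Ω : Set ℂ} (hΩ : Ω ∈ 𝒯) {ξ : ℂ} (hξ : ξ ∈ halfPlane) :
    τ (Function.invFunOn τ Ω ξ) = ξ :=
  Function.invFunOn_eq ((hτ.bijOn Ω hΩ).surjOn hξ)

lemma isUnivalent_invFunOn {Ω : Set ℂ} (hΩ : Ω ∈ 𝒯) : IsUnivalent (Function.invFunOn τ Ω) := by
  have hd : ∀ ξ ∈ halfPlane, ∃ d, d ≠ 0 ∧ HasDerivAt (Function.invFunOn τ Ω) d ξ := by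
    intro ξ hξ
    obtain ⟨z, hz, rfl⟩ := (hτ.bijOn Ω hΩ).surjOn hξ
    have h0 := deriv_ne_zero_of_injOn (hτ.isOpen Ω hΩ) (hτ.holomorphic Ω hΩ)
      (hτ.bijOn Ω hΩ).injOn hz
    exact ⟨_, inv_ne_zero h0, hasDerivAt_invFunOn_of_deriv_ne_zero (hτ.isOpen Ω hΩ)
      (hτ.holomorphic Ω hΩ) (hτ.bijOn Ω hΩ).injOn hz h0⟩
  refine ⟨fun ξ hξ => ?_, fun ξ hξ ξ' hξ' h => ?_, fun ξ hξ => ?_⟩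
  · obtain ⟨d, -, h⟩ := hd ξ hξ
    exact h.differentiableAt.differentiableWithinAt
  · rw [← hτ.apply_invFunOn hΩ hξ, h, hτ.apply_invFunOn hΩ hξ']
  · obtain ⟨d, hd0, h⟩ := hd ξ hξ
    rwa [h.deriv]

/-- Different tracts are disjoint. -/
lemma eq_of_mem_of_mem {Ω Ω' : Set ℂ} (hΩ : Ω ∈ 𝒯) (hΩ' : Ω' ∈ 𝒯) {z : ℂ} (hz : z ∈ Ω)
    (hz' : z ∈ Ω') : Ω = Ω' := by
  have hu := hτ.isUnivalent_invFunOn hΩ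
  have hu' := hτ.isUnivalent_invFunOn hΩ'
  have hξ : τ z ∈ halfPlane := (hτ.bijOn Ω hΩ).mapsTo hz
  have hev : Function.invFunOn τ Ω =ᶠ[𝓝 (τ z)] Function.invFunOn τ Ω' := by
    have h1 : Function.invFunOn τ Ω' (τ z) = z := (hτ.bijOn Ω' hΩ').injOn.leftInvOn_invFunOn hz'
    have h2 : ∀ᶠ ξ in 𝓝 (τ z), Function.invFunOn τ Ω' ξ ∈ Ω :=
      (hu'.differentiableAt hξ).continuousAt.eventually
        (by rw [h1]; exact (hτ.isOpen Ω hΩ).mem_nhds hz)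
    filter_upwards [h2, isOpen_halfPlane.mem_nhds hξ] with ξ h3 h4
    refine (hτ.bijOn Ω hΩ).injOn (hτ.invFunOn_mem hΩ h4) h3 ?_
    rw [hτ.apply_invFunOn hΩ h4, hτ.apply_invFunOn hΩ' h4]
  have heq : EqOn (Function.invFunOn τ Ω) (Function.invFunOn τ Ω') halfPlane :=
    (hu.differentiableOn.analyticOnNhd isOpen_halfPlane).eqOn_of_preconnected_of_eventuallyEq
      (hu'.differentiableOn.analyticOnNhd isOpen_halfPlane) convex_halfPlane.isPreconnected hξ hev
  refine Subset.antisymm (fun x hx => ?_) fun x hx => ?_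
  · have h1 : τ x ∈ halfPlane := (hτ.bijOn Ω hΩ).mapsTo hx
    rw [← (hτ.bijOn Ω hΩ).injOn.leftInvOn_invFunOn hx, heq h1]
    exact hτ.invFunOn_mem hΩ' h1
  · have h1 : τ x ∈ halfPlane := (hτ.bijOn Ω' hΩ').mapsTo hx
    rw [← (hτ.bijOn Ω' hΩ').injOn.leftInvOn_invFunOn hx, ← heq h1]
    exact hτ.invFunOn_mem hΩ h1

/-- The inverse branches of a model function. -/
lemma isInverseBranchFamily {f : ℂ → ℂ}
    (hf : EqOn f (fun z => Complex.exp (τ z)) (⋃₀ 𝒯)) :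
    IsInverseBranchFamily f (⋃₀ 𝒯) fun (b : 𝒯 × ℤ) ξ =>
      Function.invFunOn τ b.1 (ξ + b.2 * (2 * Real.pi * Complex.I)) := by
  have hre : ∀ n : ℤ, (n * (2 * Real.pi * Complex.I) : ℂ).re = 0 := by intro n; simp
  have hmem : ∀ (n : ℤ), ∀ z ∈ halfPlane, z + n * (2 * Real.pi * Complex.I) ∈ halfPlane := by
    intro n z hz
    change 0 < (z + n * (2 * Real.pi * Complex.I)).re
    rw [Complex.add_re, hre, add_zero]
    exact hz
  refine ⟨fun b => (hτ.isUnivalent_invFunOn b.1.2).comp_add (hre b.2), fun ξ hξ => ⟨?_, ?_, ?_⟩,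
    ?_, ?_⟩
  · intro b _
    have h1 := hτ.invFunOn_mem b.1.2 (hmem b.2 ξ hξ)
    have h2 := mem_sUnion_of_mem h1 b.1.2
    refine ⟨h2, (hf h2).trans ?_⟩
    simp only
    rw [hτ.apply_invFunOn b.1.2 (hmem b.2 ξ hξ), Complex.exp_add, Complex.exp_int_mul_two_pi_mul_I,
      mul_one]
  · rintro ⟨⟨Ω, hΩ⟩, n⟩ - ⟨⟨Ω', hΩ'⟩, n'⟩ - h
    simp only at h
    have h1 := hτ.invFunOn_mem hΩ (hmem n ξ hξ)
    have h2 := hτ.invFunOn_mem hΩ' (hmem n' ξ hξ)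
    obtain rfl := hτ.eq_of_mem_of_mem hΩ hΩ' h1 (h ▸ h2)
    have h3 := congrArg τ h
    rw [hτ.apply_invFunOn hΩ (hmem n ξ hξ), hτ.apply_invFunOn hΩ (hmem n' ξ hξ)] at h3
    have h4 := mul_right_cancel₀ Complex.two_pi_I_ne_zero (add_left_cancel h3)
    have h5 : n = n' := by exact_mod_cast h4
    rw [h5]
  · rintro z ⟨hz, hfz⟩
    obtain ⟨Ω, hΩ, hzΩ⟩ := hz
    rw [hf (mem_sUnion_of_mem hzΩ hΩ)] at hfz
    obtain ⟨n, hn⟩ := Complex.exp_eq_exp_iff_exists_int.1 hfz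
    refine ⟨⟨⟨Ω, hΩ⟩, n⟩, mem_univ _, ?_⟩
    simp only
    rw [← hn]
    exact (hτ.bijOn Ω hΩ).injOn.leftInvOn_invFunOn hzΩ
  · rintro z ⟨Ω, hΩ, hzΩ⟩
    have hn := (hτ.isOpen Ω hΩ).mem_nhds hzΩ
    have h1 : DifferentiableAt ℂ (fun z => Complex.exp (τ z)) z :=
      ((hτ.holomorphic Ω hΩ).differentiableAt hn).cexp
    refine h1.congr_of_eventuallyEq ?_
    filter_upwards [hn] with x hx using hf (mem_sUnion_of_mem hx hΩ)
  · rintro ⟨⟨Ω, hΩ⟩, n⟩ ξ hξ a ha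
    -- The points ξ + 2πi(n + k) go to infinity in the half-plane, hence so do their images under
    -- the tract inverse.
    refine ha.not_tendsto (Metric.disjoint_nhds_cobounded a) ((hτ.tendsto_infty Ω hΩ).comp ?_)
    refine tendsto_inf.2 ⟨?_, tendsto_principal.2 (Eventually.of_forall fun k =>
      hmem n _ (add_mul_two_pi_I_mem_halfPlane hξ k))⟩
    rw [← tendsto_norm_atTop_iff_cobounded]
    have h1 : Tendsto (fun k : ℕ => (k : ℝ) * (2 * Real.pi)
        + (-‖ξ + n * (2 * Real.pi * Complex.I)‖)) atTop atTop :=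
      tendsto_atTop_add_const_right _ _
        (tendsto_natCast_atTop_atTop.atTop_mul_const (by positivity))
    refine tendsto_atTop_mono (fun k => ?_) h1
    have h2 : ‖(k * (2 * Real.pi * Complex.I) : ℂ)‖ = k * (2 * Real.pi) := by
      simp [abs_of_pos Real.pi_pos]
    have h3 := norm_sub_norm_le (k * (2 * Real.pi * Complex.I) : ℂ)
      (-(ξ + n * (2 * Real.pi * Complex.I)))
    rw [norm_neg, h2] at h3
    refine (le_of_eq (by ring)).trans (h3.trans_eq ?_)
    simp only
    congr 1
    ring

end IsTractModel

end LogTract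

/-! ### Path lifting away from critical and asymptotic values -/

namespace LogTract

section PathLifting

variable {f : ℂ → ℂ} {e : ℝ → ℂ}

/-- `c` lifts the path `e` through `f` on `[0, T]`, starting at `z`. -/
structure IsLiftOn (f : ℂ → ℂ) (e : ℝ → ℂ) (z : ℂ) (T : ℝ) (c : ℝ → ℂ) : Prop where
  continuousOn : ContinuousOn c (Icc 0 T)
  zero : c 0 = z
  comp_eq : ∀ t ∈ Icc 0 T, f (c t) = e t

lemma IsLiftOn.mono {z : ℂ} {T T' : ℝ} {c : ℝ → ℂ} (hc : IsLiftOn f e z T c) (h : T' ≤ T) :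
    IsLiftOn f e z T' c :=
  ⟨hc.continuousOn.mono (Icc_subset_Icc_right h), hc.zero,
    fun t ht => hc.comp_eq t (Icc_subset_Icc_right h ht)⟩

/-- Compose e with the local inverse of f at a. The last clause says that d passes through every
lifted point close to a, which allows gluing. -/
lemma exists_section_comp (hf : Differentiable ℂ f) (he : Continuous e) {a : ℂ}
    (ha : deriv f a ≠ 0) {T : ℝ} (haT : f a = e T) :
    ∃ δ > 0, ∃ d : ℝ → ℂ, ∃ V ∈ 𝓝 a, ContinuousOn d (Icc (T - δ) (T + δ)) ∧
      (∀ t ∈ Icc (T - δ) (T + δ), f (d t) = e t) ∧ ∀ t, ∀ x ∈ V, f x = e t → d t = x := by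
  have hs : HasStrictDerivAt f (deriv f a) a := (hf.analyticAt a).hasStrictDerivAt
  set g := hs.localInverse f _ a ha with hg
  have h1 : ∀ᶠ x in 𝓝 a, g (f x) = x := hs.eventually_left_inverse ha
  have h2 : ∀ᶠ y in 𝓝 (f a), f (g y) = y := hs.eventually_right_inverse ha
  have h3 : ∀ᶠ y in 𝓝 (f a), ContinuousAt g y := by
    have h : AnalyticAt ℂ g (f a) := (hf.analyticAt a).analyticAt_localInverse ha
    exact h.eventually_analyticAt.mono fun y hy => hy.continuousAt
  rw [haT] at h2 h3
  have h4 : ∀ᶠ t in 𝓝 T, f (g (e t)) = e t ∧ ContinuousAt g (e t) :=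
    he.continuousAt.eventually (h2.and h3)
  obtain ⟨ε, hε, hball⟩ := Metric.eventually_nhds_iff_ball.1 h4
  have hsub : Icc (T - ε / 2) (T + ε / 2) ⊆ Metric.ball T ε := by
    rw [← Real.closedBall_eq_Icc]
    exact Metric.closedBall_subset_ball (by linarith)
  refine ⟨ε / 2, by linarith, g ∘ e, {x | g (f x) = x}, h1, fun t ht => ?_, fun t ht => ?_, ?_⟩
  · exact ((hball t (hsub ht)).2.comp he.continuousAt).continuousWithinAt
  · exact (hball t (hsub ht)).1
  · intro t x hx hfx
    rw [Function.comp_apply, ← hfx]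
    exact hx

/-- The set of agreement is closed, and local injectivity of f pushes it to the right. -/
lemma IsLiftOn.eqOn (hf : Differentiable ℂ f) {z : ℂ} {T : ℝ} {c c' : ℝ → ℂ}
    (hcrit : ∀ t ∈ Icc 0 T, ∀ x, f x = e t → deriv f x ≠ 0)
    (hc : IsLiftOn f e z T c) (hc' : IsLiftOn f e z T c') : EqOn c c' (Icc 0 T) := by
  refine IsClosed.Icc_subset_of_forall_exists_gt (s := {t | c t = c' t}) ?_
    (hc.zero.trans hc'.zero.symm) ?_
  · have : {t | c t = c' t} ∩ Icc 0 T = {t ∈ Icc 0 T | c t = c' t} := by ext; simp [and_comm]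
    rw [this]
    exact isClosed_Icc.isClosed_eq hc.continuousOn hc'.continuousOn
  · rintro x ⟨hx, hxI⟩ y hy
    have hxI' : x ∈ Icc 0 T := Ico_subset_Icc_self hxI
    have hs : HasStrictDerivAt f (deriv f (c x)) (c x) := (hf.analyticAt _).hasStrictDerivAt
    have hd := hcrit x hxI' _ (hc.comp_eq x hxI')
    have hle : 𝓝[>] x ≤ 𝓝[Icc 0 T] x := by
      rw [← nhdsWithin_Ioo_eq_nhdsGT hxI.2]
      exact nhdsWithin_mono _ fun t ht => ⟨hxI.1.trans ht.1.le, ht.2.le⟩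
    have h1 := (((hc.continuousOn x hxI').mono_left hle).eventually
      (hs.eventually_left_inverse hd))
    have h2 : ∀ᶠ t in 𝓝[>] x, hs.localInverse f _ _ hd (f (c' t)) = c' t := by
      have h := hs.eventually_left_inverse hd
      have hcc : 𝓝 (c x) = 𝓝 (c' x) := congrArg 𝓝 hx
      rw [hcc] at h
      exact ((hc'.continuousOn x hxI').mono_left hle).eventually h
    have h3 : ∀ᶠ t in 𝓝[>] x, t ∈ Ioo x (min y T) := Ioo_mem_nhdsGT (lt_min hy hxI.2)
    obtain ⟨t, h1, h2, h3⟩ := (h1.and (h2.and h3)).exists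
    have htI : t ∈ Icc 0 T := ⟨hxI.1.trans h3.1.le, (h3.2.trans_le (min_le_right _ _)).le⟩
    refine ⟨t, ?_, h3.1, (h3.2.trans_le (min_le_left _ _)).le⟩
    change c t = c' t
    rw [← h1, ← h2, hc.comp_eq t htI, hc'.comp_eq t htI]

lemma IsLiftOn.glue {z : ℂ} {t₀ T : ℝ} {c d : ℝ → ℂ} (h0 : 0 ≤ t₀)
    (hc : IsLiftOn f e z t₀ c) (hd : ContinuousOn d (Icc t₀ T))
    (hfd : ∀ t ∈ Icc t₀ T, f (d t) = e t) (heq : d t₀ = c t₀) :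
    ∃ c', IsLiftOn f e z T c' := by
  refine ⟨fun t => if t ≤ t₀ then c t else d t, ?_, ?_, ?_⟩
  · refine ContinuousOn.if ?_ ?_ ?_
    · rintro t ⟨-, ht⟩
      have : t = t₀ := by
        have := frontier_le_subset_eq continuous_id continuous_const ht
        exact this
      rw [this, heq]
    · refine hc.continuousOn.mono ?_
      rintro t ⟨h1, h2⟩
      have h3 : t ∈ Iic t₀ := closure_minimal (fun x hx => hx) isClosed_Iic h2
      exact ⟨h1.1, h3⟩
    · refine hd.mono ?_
      rintro t ⟨h1, h2⟩
      simp only [not_le] at h2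
      have := closure_lt_subset_le continuous_const continuous_id h2
      exact ⟨this, h1.2⟩
  · simp [h0, hc.zero]
  · intro t ht
    by_cases h : t ≤ t₀
    · simp only [h, if_true]
      exact hc.comp_eq t ⟨ht.1, h⟩
    · simp only [h, if_false]
      exact hfd t ⟨(not_le.1 h).le, ht.2⟩

/-- A lift on `[0, T)` that does not tend to infinity extends beyond `T`. -/
lemma exists_lift_gt (hf : Differentiable ℂ f) (he : Continuous e) {z : ℂ} {T : ℝ} (hT : 0 < T)
    (hcrit : ∀ x, f x = e T → deriv f x ≠ 0) (hasy : ¬ IsAsymptoticValue f (e T))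
    {c : ℝ → ℂ} (hc : ∀ t, 0 ≤ t → t < T → IsLiftOn f e z t c) :
    ∃ δ > 0, ∃ c', IsLiftOn f e z (T + δ) c' := by
  have hcT : ContinuousOn c (Ico 0 T) := by
    intro t ht
    obtain ⟨t', h1, h2⟩ := exists_between ht.2
    refine ((hc t' (ht.1.trans h1.le) h2).continuousOn t ⟨ht.1, h1.le⟩).mono_of_mem_nhdsWithin ?_
    refine mem_nhdsWithin.2 ⟨Iio t', isOpen_Iio, h1, fun x hx => ⟨hx.2.1, hx.1.le⟩⟩
  have hfc : ∀ t ∈ Ico 0 T, f (c t) = e t := fun t ht =>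
    (hc t ht.1 ht.2).comp_eq t ⟨ht.1, le_rfl⟩
  have hIco : ∀ᶠ t in 𝓝[<] T, t ∈ Ico 0 T :=
    mem_of_superset (Ioo_mem_nhdsLT hT) Ioo_subset_Ico_self
  -- Reparametrised over [0, ∞), a lift escaping to infinity would make e T an asymptotic value.
  have hnot : ¬ Tendsto c (𝓝[<] T) (cobounded ℂ) := by
    intro h
    refine hasy ⟨fun r => c (T * (r / (1 + r))), ?_, ?_, ?_⟩
    all_goals
      have hmem : ∀ r ∈ Ici (0 : ℝ), T * (r / (1 + r)) ∈ Ico 0 T := by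
        intro r (hr : 0 ≤ r)
        have h1 : r / (1 + r) < 1 := by rw [div_lt_one (by positivity)]; linarith
        exact ⟨by positivity, by nlinarith⟩
      have htend : Tendsto (fun r : ℝ => T * (r / (1 + r))) atTop (𝓝[<] T) := by
        refine tendsto_nhdsWithin_iff.2 ⟨?_, ?_⟩
        · have h1 : Tendsto (fun r : ℝ => T * (1 - (1 + r)⁻¹)) atTop (𝓝 (T * (1 - 0))) :=
            (tendsto_const_nhds.sub (tendsto_inv_atTop_zero.comp
              (tendsto_atTop_add_const_left _ _ tendsto_id))).const_mul _
          rw [sub_zero, mul_one] at h1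
          refine h1.congr' ?_
          filter_upwards [eventually_ge_atTop 0] with r hr
          have : 1 + r ≠ 0 := by positivity
          field_simp
          ring
        · filter_upwards [eventually_ge_atTop 0] with r hr using (hmem r hr).2
    · refine hcT.comp ?_ hmem
      refine continuousOn_const.mul (continuousOn_id.div (by fun_prop) ?_)
      intro r (hr : 0 ≤ r)
      positivity
    · exact h.comp htend
    · have h1 : Tendsto e (𝓝[<] T) (𝓝 (e T)) := he.continuousAt.mono_left nhdsWithin_le_nhds
      refine (h1.comp htend).congr' ?_
      filter_upwards [eventually_ge_atTop 0] with r hr using (hfc _ (hmem r hr)).symm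
  obtain ⟨R, hR⟩ : ∃ R, ∃ᶠ t in 𝓝[<] T, c t ∈ Metric.closedBall (0 : ℂ) R := by
    by_contra! h
    refine hnot ?_
    rw [← tendsto_norm_atTop_iff_cobounded, tendsto_atTop]
    intro R
    filter_upwards [h R] with t ht
    rw [mem_closedBall_zero_iff, not_le] at ht
    exact ht.le
  -- The lift returns to a compact set arbitrarily close to T. It therefore clusters at a preimage a
  -- of e T, and meets the local section through a just before T.
  obtain ⟨a, -, ha⟩ := (isCompact_closedBall (0 : ℂ) R).exists_mapClusterPt_of_frequently hR
  have hfa : f a = e T := by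
    have h1 : MapClusterPt (f a) (𝓝[<] T) (f ∘ c) := ha.tendsto_comp hf.continuous.continuousAt
    have h2 : Tendsto (f ∘ c) (𝓝[<] T) (𝓝 (e T)) := by
      refine (he.continuousAt.mono_left nhdsWithin_le_nhds).congr' ?_
      filter_upwards [hIco] with t ht using (hfc t ht).symm
    exact eq_of_nhds_neBot (NeBot.mono h1 (inf_le_inf_left _ h2))
  obtain ⟨δ, hδ, d, V, hV, hd, hfd, hdV⟩ := exists_section_comp hf he (hcrit a hfa) hfa
  have h3 : ∀ᶠ t in 𝓝[<] T, t ∈ Ioo (T - δ) T := Ioo_mem_nhdsLT (by linarith)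
  obtain ⟨t, htV, ht1, ht2⟩ := ((ha.frequently hV).and_eventually (hIco.and h3)).exists
  refine ⟨δ, hδ, (hc t ht1.1 ht1.2).glue ht1.1
    (hd.mono (Icc_subset_Icc_left ht2.1.le))
    (fun x hx => hfd x ⟨ht2.1.le.trans hx.1, hx.2⟩) (hdV t _ htV (hfc t ht1))⟩

/-- Paths avoiding critical and asymptotic values can be lifted. -/
theorem exists_isLiftOn (hf : Differentiable ℂ f) (he : Continuous e)
    (hcrit : ∀ t ∈ Icc (0 : ℝ) 1, ∀ x, f x = e t → deriv f x ≠ 0)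
    (hasy : ∀ t ∈ Icc (0 : ℝ) 1, ¬ IsAsymptoticValue f (e t)) {z : ℂ} (hz : f z = e 0) :
    ∃ c, IsLiftOn f e z 1 c := by
  set S : Set ℝ := {T | T ∈ Icc (0 : ℝ) 1 ∧ ∃ c, IsLiftOn f e z T c} with hS
  have h0S : (0 : ℝ) ∈ S := by
    refine ⟨by simp, fun _ => z, continuousOn_const, rfl, ?_⟩
    intro t ht
    rw [Icc_self, mem_singleton_iff] at ht
    rw [ht, hz]
  have hbdd : BddAbove S := ⟨1, fun T hT => hT.1.2⟩
  set T := sSup S with hT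
  have hT0 : 0 ≤ T := le_csSup hbdd h0S
  have hT1 : T ≤ 1 := csSup_le ⟨0, h0S⟩ fun T hT => hT.1.2
  have hTI : T ∈ Icc (0 : ℝ) 1 := ⟨hT0, hT1⟩
  have hext : ∃ δ > 0, ∃ c', IsLiftOn f e z (T + δ) c' := by
    rcases hT0.eq_or_lt with h0 | h0
    · have haT : f z = e T := by rw [hz, ← h0]
      obtain ⟨δ, hδ, d, V, hV, hd, hfd, hdV⟩ :=
        exists_section_comp hf he (hcrit T hTI z haT) haT
      have hsub : Icc 0 (T + δ) ⊆ Icc (T - δ) (T + δ) := Icc_subset_Icc_left (by linarith)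
      exact ⟨δ, hδ, d, hd.mono hsub, hdV 0 z (mem_of_mem_nhds hV) hz,
        fun t ht => hfd t (hsub ht)⟩
    · have hlift : ∀ t, t < T → ∃ c, IsLiftOn f e z t c := by
        intro t ht
        obtain ⟨t', ⟨-, c, hc⟩, htt'⟩ := exists_lt_of_lt_csSup ⟨0, h0S⟩ ht
        exact ⟨c, hc.mono htt'.le⟩
      choose! C hC using hlift
      -- By uniqueness the chosen lifts agree, so the diagonal t ↦ C t t is one lift on [0, T).
      have heq : ∀ t, 0 ≤ t → ∀ t', t ≤ t' → t' < T → C t t = C t' t := by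
        intro t ht t' htt' ht'
        refine IsLiftOn.eqOn hf (fun x hx => hcrit x ?_) (hC t (htt'.trans_lt ht'))
          ((hC t' ht').mono htt') ⟨ht, le_rfl⟩
        exact ⟨hx.1, hx.2.trans (htt'.trans (ht'.le.trans hT1))⟩
      refine exists_lift_gt hf he h0 (hcrit T hTI) (hasy T hTI) (c := fun t => C t t) ?_
      intro t ht htT
      refine ⟨(hC t htT).continuousOn.congr fun x hx => heq x hx.1 t hx.2 htT,
        (hC 0 h0).zero, fun x hx => ?_⟩
      exact (hC x (hx.2.trans_lt htT)).comp_eq x ⟨hx.1, le_rfl⟩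
  obtain ⟨δ, hδ, c, hc⟩ := hext
  by_cases h1 : 1 ≤ T + δ
  · exact ⟨c, hc.mono h1⟩
  · have : T + δ ∈ S := ⟨⟨by linarith, (not_le.1 h1).le⟩, c, hc⟩
    linarith [le_csSup hbdd this]

end PathLifting

end LogTract

/-! ### Inverse branches of functions of class B -/

namespace LogTract

lemma one_lt_norm_exp {ξ : ℂ} (hξ : ξ ∈ halfPlane) : 1 < ‖Complex.exp ξ‖ := by
  rw [Complex.norm_exp, Real.one_lt_exp_iff]
  exact hξ

/-- An entire function of polynomial growth is a polynomial. -/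
lemma exists_polynomial_of_norm_le {f : ℂ → ℂ} (hf : Differentiable ℂ f) {C : ℝ} {n : ℕ}
    (h : ∀ᶠ z in cobounded ℂ, ‖f z‖ ≤ C * ‖z‖ ^ n) :
    ∃ P : Polynomial ℂ, f = fun z => P.eval z := by
  obtain ⟨R₀, -, hR₀⟩ := (Metric.hasBasis_cobounded_compl_closedBall (0 : ℂ)).eventually_iff.1 h
  -- Cauchy estimates on circles of radius R → ∞.
  have hzero : ∀ k, n < k → iteratedDeriv k f 0 = 0 := by
    intro k hk
    have hle : ∀ᶠ R : ℝ in atTop, ‖iteratedDeriv k f 0‖ ≤ k.factorial * C / R := by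
      filter_upwards [eventually_gt_atTop R₀, eventually_ge_atTop 1] with R hR hR1
      have hRpos : 0 < R := by linarith
      have hs : ∀ z ∈ Metric.sphere (0 : ℂ) R, ‖f z‖ ≤ C * R ^ n := by
        intro z hz
        rw [mem_sphere_zero_iff_norm] at hz
        have := hR₀ (show z ∈ (Metric.closedBall (0 : ℂ) R₀)ᶜ by
          rw [mem_compl_iff, mem_closedBall_zero_iff, hz]; exact not_le.2 hR)
        rwa [hz] at this
      have hC : 0 ≤ C := by
        have h1 := (norm_nonneg _).trans (hs (R : ℂ) (by simp [abs_of_pos hRpos]))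
        exact nonneg_of_mul_nonneg_left h1 (by positivity)
      refine (Complex.norm_iteratedDeriv_le_of_forall_mem_sphere_norm_le k hRpos
        hf.diffContOnCl hs).trans ?_
      rw [div_le_div_iff₀ (by positivity) hRpos]
      have h2 : R ^ n * R ≤ R ^ k := by
        rw [← pow_succ]
        exact pow_le_pow_right₀ hR1 hk
      calc k.factorial * (C * R ^ n) * R = k.factorial * C * (R ^ n * R) := by ring
        _ ≤ k.factorial * C * R ^ k := by gcongr
    have h0 : Tendsto (fun R : ℝ => k.factorial * C / R) atTop (𝓝 0) :=
      tendsto_const_nhds.div_atTop tendsto_id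
    exact norm_le_zero_iff.1 (ge_of_tendsto h0 hle)
  refine ⟨∑ k ∈ Finset.range (n + 1),
    Polynomial.C ((k.factorial : ℂ)⁻¹ * iteratedDeriv k f 0) * Polynomial.X ^ k, funext fun z => ?_⟩
  rw [← Complex.taylorSeries_eq_of_entire' 0 z hf, tsum_eq_sum (s := Finset.range (n + 1)),
    Polynomial.eval_finsetSum]
  · simp
  · intro k hk
    rw [hzero k (by simpa using hk)]
    simp

/-- A solution `φ` of `f ∘ φ = exp` that is periodic with period `2πin` forces polynomial growth
of `f`. -/
lemma norm_le_of_periodic {f φ : ℂ → ℂ} (hf : Differentiable ℂ f)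
    (hφ : DifferentiableOn ℂ φ halfPlane) (hfφ : ∀ ξ ∈ halfPlane, f (φ ξ) = Complex.exp ξ)
    {n : ℕ} (hn : 0 < n)
    (hper : ∀ ξ ∈ halfPlane, φ (ξ - n * (2 * Real.pi * Complex.I)) = φ ξ) :
    ∃ C : ℝ, ∀ᶠ z in cobounded ℂ, ‖f z‖ ≤ C * ‖z‖ ^ n := by
  -- f is bounded on compact sets while |f(φ ξ)| = exp(Re ξ), so φ tends to infinity with Re ξ.
  have hinf : ∀ R : ℝ, ∃ A : ℝ, ∀ ξ ∈ halfPlane, A < ξ.re → R < ‖φ ξ‖ := by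
    intro R
    obtain ⟨M, hM⟩ := (isCompact_closedBall (0 : ℂ) R).exists_bound_of_continuousOn
      hf.continuous.continuousOn
    refine ⟨M, fun ξ hξ hA => ?_⟩
    by_contra! h
    have h1 := hM (φ ξ) (mem_closedBall_zero_iff.2 h)
    rw [hfφ ξ hξ, Complex.norm_exp] at h1
    linarith [Real.add_one_le_exp ξ.re]
  set h : ℝ := 2 * Real.pi * n with hh
  have hh0 : 0 < h := by positivity
  -- The substitution ξ = -iζ turns the half-plane upright, and 1/φ has real period 2πn there. The
  -- value 0 elsewhere keeps G periodic on all of ℂ.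
  set G : ℂ → ℂ := fun ζ => if 0 < ζ.im then (φ (-Complex.I * ζ))⁻¹ else 0 with hG
  have hmem : ∀ ζ : ℂ, 0 < ζ.im → -Complex.I * ζ ∈ halfPlane := by
    intro ζ hζ
    change 0 < (-Complex.I * ζ).re
    simpa using hζ
  have hre : ∀ ζ : ℂ, (-Complex.I * ζ).re = ζ.im := by intro ζ; simp
  have hGper : Function.Periodic G h := by
    intro ζ
    simp only [hG, Complex.add_im, Complex.ofReal_im, add_zero]
    split_ifs with hζ
    · rw [← hper _ (hmem ζ hζ)]
      congr 2
      rw [hh]; push_cast; ring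
    · rfl
  obtain ⟨A₀, hA₀⟩ := hinf 0
  have hbig : ∀ A : ℝ, ∀ᶠ ζ in comap Complex.im atTop, A < ζ.im := fun A =>
    tendsto_comap.eventually (eventually_gt_atTop A)
  have hGd : ∀ᶠ ζ in comap Complex.im atTop, DifferentiableAt ℂ G ζ := by
    filter_upwards [hbig 0, hbig A₀] with ζ h1 h2
    have h3 : φ (-Complex.I * ζ) ≠ 0 :=
      norm_pos_iff.1 (hA₀ _ (hmem ζ h1) (by rwa [hre]))
    have h4 : DifferentiableAt ℂ (fun ζ => φ (-Complex.I * ζ)) ζ :=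
      (hφ.differentiableAt (isOpen_halfPlane.mem_nhds (hmem ζ h1))).comp ζ (by fun_prop)
    refine (h4.inv h3).congr_of_eventuallyEq ?_
    filter_upwards [(isOpen_lt continuous_const Complex.continuous_im).mem_nhds h1] with x hx
    simp only [hG]
    rw [if_pos hx, Pi.inv_apply]
  have hG0 : ZeroAtFilter (comap Complex.im atTop) G := by
    rw [ZeroAtFilter, Metric.tendsto_nhds]
    intro ε hε
    obtain ⟨A, hA⟩ := hinf ε⁻¹
    filter_upwards [hbig 0, hbig A] with ζ h1 h2
    have h3 := hA _ (hmem ζ h1) (by rwa [hre])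
    simp only [hG]
    rw [if_pos h1, dist_zero_right, norm_inv]
    exact inv_lt_of_inv_lt₀ hε h3
  set K := Function.Periodic.cuspFunction h G with hK
  have hK0 : K 0 = 0 := Function.Periodic.cuspFunction_zero_of_zero_at_inf hh0 hG0
  have hKd : DifferentiableAt ℂ K 0 :=
    Function.Periodic.differentiableAt_cuspFunction_zero hh0 hGper hGd hG0.boundedAtFilter
  have hKan : AnalyticAt ℂ K 0 :=
    Complex.analyticAt_of_differentiable_on_punctured_nhds_of_continuousAt
      (Function.Periodic.eventually_differentiableAt_cuspFunction_nhds_ne_zero hh0 hGper hGd)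
      hKd.continuousAt
  have hval : ∀ᶠ q in 𝓝[≠] (0 : ℂ), K q ≠ 0 ∧ f (K q)⁻¹ = Complex.exp
      (-Complex.I * Function.Periodic.invQParam h q) := by
    have hlim := Function.Periodic.invQParam_tendsto hh0
    filter_upwards [hlim.eventually (hbig 0), hlim.eventually (hbig A₀), self_mem_nhdsWithin]
      with q h1 h2 h3
    have h4 : K q = (φ (-Complex.I * Function.Periodic.invQParam h q))⁻¹ := by
      rw [hK, Function.Periodic.cuspFunction_eq_of_nonzero h G h3]
      simp only [hG]
      rw [if_pos h1]
    have h5 : φ (-Complex.I * Function.Periodic.invQParam h q) ≠ 0 :=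
      norm_pos_iff.1 (hA₀ _ (hmem _ h1) (by rwa [hre]))
    rw [h4, inv_inv]
    exact ⟨inv_ne_zero h5, hfφ _ (hmem _ h1)⟩
  -- In the variable q = exp(2πiζ/h), K is holomorphic at 0 with |K q| ≤ C|q|, while |f(1/K q)| =
  -- |q|⁻ⁿ. Since K is open at 0, every z near infinity is some 1/K q.
  obtain ⟨C, hC, hKC⟩ := hKd.isBigO_sub.exists_pos
  have hKC' := hKC.bound
  have hopen : 𝓝 (K 0) ≤ map K (𝓝 0) := by
    refine hKan.eventually_constant_or_nhds_le_map_nhds.resolve_left fun hc => ?_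
    obtain ⟨q, h1, h2⟩ := ((hc.filter_mono nhdsWithin_le_nhds).and hval).exists
    exact h2.1 (h1.trans hK0)
  refine ⟨C ^ n, ?_⟩
  have hgood : ∀ᶠ y in 𝓝 (0 : ℂ), y ≠ 0 → ‖f y⁻¹‖ ≤ C ^ n * ‖y⁻¹‖ ^ n := by
    rw [hK0] at hopen
    refine hopen ?_
    rw [mem_map]
    filter_upwards [eventually_nhdsWithin_iff.1 hval, hKC'] with q h1 h2 hy
    have hq : q ≠ 0 := by rintro rfl; exact hy hK0
    obtain ⟨-, h3⟩ := h1 hq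
    rw [hK0, sub_zero, sub_zero] at h2
    rw [h3, Complex.norm_exp, hre, Function.Periodic.im_invQParam, norm_inv]
    have hq0 : 0 < ‖q‖ := norm_pos_iff.2 hq
    have hy0 : 0 < ‖K q‖ := norm_pos_iff.2 hy
    have e : Real.exp (-h / (2 * Real.pi) * Real.log ‖q‖) = (‖q‖⁻¹) ^ n := by
      rw [← Real.exp_log (inv_pos.2 hq0), ← Real.exp_nat_mul, Real.log_inv, hh]
      congr 1
      field_simp
    rw [e, ← mul_pow]
    refine pow_le_pow_left₀ (by positivity) ?_ n
    rw [inv_le_iff_one_le_mul₀ hq0, mul_assoc, mul_comm, mul_assoc, ← div_eq_inv_mul,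
      le_div_iff₀ hy0]
    linarith
  have hinv : Tendsto (fun z : ℂ => z⁻¹) (cobounded ℂ) (𝓝 0) := tendsto_inv₀_cobounded
  filter_upwards [hinv.eventually hgood, eventually_ne_cobounded (0 : ℂ)] with z h1 h2
  simpa using h1 (inv_ne_zero h2)

/-- Two holomorphic solutions of `f ∘ φ = exp` agreeing at a point coincide. -/
lemma eqOn_of_comp_eq_exp {f φ ψ : ℂ → ℂ} (hf : Differentiable ℂ f)
    (hcrit : ∀ x, 1 < ‖f x‖ → deriv f x ≠ 0)
    (hφ : DifferentiableOn ℂ φ halfPlane) (hfφ : ∀ ξ ∈ halfPlane, f (φ ξ) = Complex.exp ξ)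
    (hψ : DifferentiableOn ℂ ψ halfPlane) (hfψ : ∀ ξ ∈ halfPlane, f (ψ ξ) = Complex.exp ξ)
    {ξ : ℂ} (hξ : ξ ∈ halfPlane) (h : φ ξ = ψ ξ) : EqOn φ ψ halfPlane := by
  refine (hφ.analyticOnNhd isOpen_halfPlane).eqOn_of_preconnected_of_eventuallyEq
    (hψ.analyticOnNhd isOpen_halfPlane) convex_halfPlane.isPreconnected hξ ?_
  have hn := isOpen_halfPlane.mem_nhds hξ
  have hd := hcrit (φ ξ) (by rw [hfφ ξ hξ]; exact one_lt_norm_exp hξ)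
  have hinv := ((hf.analyticAt (φ ξ)).hasStrictDerivAt).eventually_left_inverse hd
  have h1 := (hφ.continuousOn.continuousAt hn).eventually hinv
  have hnn : 𝓝 (φ ξ) = 𝓝 (ψ ξ) := congrArg 𝓝 h
  rw [hnn] at hinv
  have h2 := (hψ.continuousOn.continuousAt hn).eventually hinv
  filter_upwards [h1, h2, hn] with x hx1 hx2 hx
  rw [← hx1, ← hx2, hfφ x hx, hfψ x hx]

/-- Existence of inverse branches over the right half-plane. -/
lemma exists_comp_eq_exp {f : ℂ → ℂ} (hf : Differentiable ℂ f)
    (hcrit : ∀ x, 1 < ‖f x‖ → deriv f x ≠ 0)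
    (hasy : ∀ a, 1 < ‖a‖ → ¬ IsAsymptoticValue f a)
    {ξ₀ z : ℂ} (hξ₀ : ξ₀ ∈ halfPlane) (hz : f z = Complex.exp ξ₀) :
    ∃ φ : ℂ → ℂ, DifferentiableOn ℂ φ halfPlane ∧ φ ξ₀ = z ∧
      ∀ ξ ∈ halfPlane, f (φ ξ) = Complex.exp ξ := by
  classical
  have hseg : ∀ ξ ∈ halfPlane, ∀ t ∈ Icc (0 : ℝ) 1, ξ₀ + t * (ξ - ξ₀) ∈ halfPlane := by
    intro ξ hξ t ht
    have := convex_halfPlane.add_smul_sub_mem hξ₀ hξ ht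
    simpa using this
  -- The lift starting at z over the exponential of the segment from ξ₀ to ξ; φ ξ will be its
  -- endpoint.
  have hlift : ∀ ξ : halfPlane, ∃ c,
      IsLiftOn f (fun t : ℝ => Complex.exp (ξ₀ + t * ((ξ : ℂ) - ξ₀))) z 1 c := by
    intro ξ
    refine exists_isLiftOn hf (by fun_prop) (fun t ht x hx => hcrit x ?_)
      (fun t ht => hasy _ (one_lt_norm_exp (hseg ξ ξ.2 t ht))) (by simpa using hz)
    rw [hx]
    exact one_lt_norm_exp (hseg ξ ξ.2 t ht)
  choose c hc using hlift
  have hval : ∀ (t : unitInterval) (ξ : halfPlane),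
      f (c ξ t) = Complex.exp (ξ₀ + (t : ℝ) * ((ξ : ℂ) - ξ₀)) := fun t ξ =>
    (hc ξ).comp_eq t t.2
  set E : Set ℂ := {x | 1 < ‖f x‖} with hE
  have hEo : IsOpen E := isOpen_lt continuous_const hf.continuous.norm
  set p : E → ℂ := fun x => f x with hp
  have hploc : IsLocalHomeomorph p := by
    have h1 : IsLocalHomeomorphOn f E := by
      refine IsLocalHomeomorphOn.mk f E fun x hx => ?_
      have hs := ((hf.analyticAt x).hasStrictDerivAt).hasStrictFDerivAt_equiv (hcrit x hx)
      exact ⟨hs.toOpenPartialHomeomorph f, hs.mem_toOpenPartialHomeomorph_source, fun _ _ => rfl⟩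
    rw [isLocalHomeomorph_iff_isLocalHomeomorphOn_univ]
    exact h1.comp (hEo.isOpenEmbedding_subtypeVal.isLocalHomeomorph.isLocalHomeomorphOn.mono
      (subset_univ _)) fun x _ => x.2
  have hsep : IsSeparatedMap p := T2Space.isSeparatedMap p
  let g : unitInterval × halfPlane → E := fun x => ⟨c x.2 x.1, by
    change 1 < ‖f (c x.2 x.1)‖
    rw [hval]
    exact one_lt_norm_exp (hseg _ x.2.2 _ x.1.2)⟩
  have hcA : ∀ ξ : halfPlane, Continuous fun t : unitInterval => g (t, ξ) := by
    intro ξ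
    refine Continuous.subtype_mk ?_ _
    exact (hc ξ).continuousOn.comp_continuous continuous_subtype_val fun t => t.2
  -- Over |w| > 1, f is a separated local homeomorphism, so continuity in t and at t = 0 implies
  -- joint continuity.
  have hgc : Continuous g := by
    refine hploc.continuous_lift hsep
      (f := ⟨fun x : unitInterval × halfPlane => Complex.exp (ξ₀ + (x.1 : ℝ) * ((x.2 : ℂ) - ξ₀)), by fun_prop⟩)
      ?_ ?_ hcA
    · funext x
      exact hval x.1 x.2
    · have : (fun ξ : halfPlane => g (0, ξ)) = fun _ => g (0, ⟨ξ₀, hξ₀⟩) := by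
        funext ξ
        apply Subtype.ext
        change c ξ ((0 : unitInterval) : ℝ) = c ⟨ξ₀, hξ₀⟩ ((0 : unitInterval) : ℝ)
        rw [Icc.coe_zero, (hc ξ).zero, (hc _).zero]
      rw [this]
      exact continuous_const
  set φ : ℂ → ℂ := fun ξ => if h : ξ ∈ halfPlane then c ⟨ξ, h⟩ 1 else 0 with hφ
  have hφv : ∀ ξ (h : ξ ∈ halfPlane), φ ξ = c ⟨ξ, h⟩ 1 := fun ξ h => dif_pos h
  have hfφ : ∀ ξ ∈ halfPlane, f (φ ξ) = Complex.exp ξ := by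
    intro ξ hξ
    rw [hφv ξ hξ]
    have := hval 1 ⟨ξ, hξ⟩
    simpa using this
  have hφc : ContinuousOn φ halfPlane := by
    rw [continuousOn_iff_continuous_domRestrict]
    have h1 : Continuous fun ξ : halfPlane => ((g (1, ξ) : E) : ℂ) := by fun_prop
    refine h1.congr fun ξ => ?_
    change c ξ ((1 : unitInterval) : ℝ) = φ ξ
    rw [hφv ξ ξ.2, Icc.coe_one]
  refine ⟨φ, fun ξ hξ => ?_, ?_, hfφ⟩
  · have hn := isOpen_halfPlane.mem_nhds hξ
    exact (hasDerivAt_of_comp_eq (hφc.continuousAt hn) (hf.analyticAt _).hasStrictDerivAt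
      (hcrit _ (by rw [hfφ ξ hξ]; exact one_lt_norm_exp hξ)) (Complex.hasDerivAt_exp ξ)
      (by filter_upwards [hn] with x hx using hfφ x hx)).differentiableAt.differentiableWithinAt
  · rw [hφv ξ₀ hξ₀]
    have h1 := hsep.const_of_comp hploc.isLocallyInjective (hcA ⟨ξ₀, hξ₀⟩)
      (fun t t' => by
        change f (c _ t) = f (c _ t')
        rw [hval, hval]; simp) 1 0
    have h2 := congrArg Subtype.val h1
    change c ⟨ξ₀, hξ₀⟩ ((1 : unitInterval) : ℝ) = c ⟨ξ₀, hξ₀⟩ ((0 : unitInterval) : ℝ) at h2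
    rw [Icc.coe_one, Icc.coe_zero, (hc _).zero] at h2
    exact h2

/-- For transcendental `f`, holomorphic solutions of `f ∘ φ = exp` are univalent. -/
lemma isUnivalent_of_comp_eq_exp {f φ : ℂ → ℂ} (hf : Differentiable ℂ f)
    (htr : ∀ P : Polynomial ℂ, f ≠ fun z => P.eval z)
    (hcrit : ∀ x, 1 < ‖f x‖ → deriv f x ≠ 0)
    (hφ : DifferentiableOn ℂ φ halfPlane) (hfφ : ∀ ξ ∈ halfPlane, f (φ ξ) = Complex.exp ξ) :
    IsUnivalent φ := by
  have hmem : ∀ n : ℕ, ∀ ξ ∈ halfPlane, ξ - n * (2 * Real.pi * Complex.I) ∈ halfPlane := by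
    intro n ξ hξ
    change 0 < (ξ - n * (2 * Real.pi * Complex.I)).re
    simpa using (show 0 < ξ.re from hξ)
  -- One coincidence at distance 2πin makes φ periodic by uniqueness of branches, and then f is a
  -- polynomial.
  have hno : ∀ n : ℕ, 0 < n → ∀ ξ ∈ halfPlane,
      φ (ξ - n * (2 * Real.pi * Complex.I)) ≠ φ ξ := by
    intro n hn ξ hξ h
    have hper : EqOn (fun ξ => φ (ξ - n * (2 * Real.pi * Complex.I))) φ halfPlane := by
      refine eqOn_of_comp_eq_exp hf hcrit (hφ.comp (by fun_prop) (hmem n)) (fun x hx => ?_)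
        hφ hfφ hξ h
      rw [hfφ _ (hmem n x hx), Complex.exp_sub, Complex.exp_nat_mul_two_pi_mul_I, div_one]
    obtain ⟨C, hC⟩ := norm_le_of_periodic hf hφ hfφ hn hper
    obtain ⟨P, hP⟩ := exists_polynomial_of_norm_le hf hC
    exact htr P hP
  refine ⟨hφ, fun x hx y hy h => ?_, fun ξ hξ h0 => ?_⟩
  · have h1 : Complex.exp x = Complex.exp y := by rw [← hfφ x hx, h, hfφ y hy]
    obtain ⟨n, hn⟩ := Complex.exp_eq_exp_iff_exists_int.1 h1
    obtain ⟨k, rfl | rfl⟩ := n.eq_nat_or_neg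
    · rcases k.eq_zero_or_pos with rfl | hk
      · simpa using hn
      · refine absurd ?_ (hno k hk x hx)
        rw [h, hn]
        push_cast
        rw [add_sub_cancel_right]
    · rcases k.eq_zero_or_pos with rfl | hk
      · simpa using hn
      · refine absurd ?_ (hno k hk y hy)
        rw [← h, hn]
        push_cast
        rw [neg_mul, sub_eq_add_neg]
  · have hn := isOpen_halfPlane.mem_nhds hξ
    have h1 := (hf (φ ξ)).hasDerivAt.comp ξ (hφ.differentiableAt hn).hasDerivAt
    have h2 : HasDerivAt (f ∘ φ) (Complex.exp ξ) ξ := by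
      refine (Complex.hasDerivAt_exp ξ).congr_of_eventuallyEq ?_
      filter_upwards [hn] with x hx using hfφ x hx
    rw [h0, mul_zero] at h1
    exact Complex.exp_ne_zero ξ (h2.unique h1)

/-- The inverse branches of a function of class `B`. -/
lemma IsClassB.exists_isInverseBranchFamily {f : ℂ → ℂ} (hf : IsClassB f)
    (hS : singularSet f ⊆ Metric.ball 0 1) :
    ∃ (B : Type) (φ : B → ℂ → ℂ), IsInverseBranchFamily f (f ⁻¹' {w | 1 < ‖w‖}) φ := by
  have hcrit' : ∀ x, 1 ≤ ‖f x‖ → deriv f x ≠ 0 := by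
    intro x hx h
    have := hS (subset_closure (Or.inl ⟨x, h, rfl⟩))
    rw [mem_ball_zero_iff] at this
    linarith
  have hcrit : ∀ x, 1 < ‖f x‖ → deriv f x ≠ 0 := fun x hx => hcrit' x hx.le
  have hasy : ∀ a, 1 < ‖a‖ → ¬ IsAsymptoticValue f a := by
    intro a ha h
    have := hS (subset_closure (Or.inr h))
    rw [mem_ball_zero_iff] at this
    linarith
  have h1H : (1 : ℂ) ∈ halfPlane := by simp [halfPlane]
  -- Branches are labelled by their value at ξ = 1, that is, by the fibre over e.
  have hex : ∀ z : {z : ℂ // f z = Complex.exp 1}, ∃ φ : ℂ → ℂ,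
      DifferentiableOn ℂ φ halfPlane ∧ φ 1 = z ∧ ∀ ξ ∈ halfPlane, f (φ ξ) = Complex.exp ξ :=
    fun z => exists_comp_eq_exp hf.entire hcrit hasy h1H z.2
  choose φ hφ hφ1 hfφ using hex
  have huni := fun z => isUnivalent_of_comp_eq_exp hf.entire hf.transcendental hcrit
    (hφ z) (hfφ z)
  refine ⟨_, φ, huni, fun ξ hξ => ⟨?_, ?_, ?_⟩, fun z _ => hf.entire z, ?_⟩
  · intro z _
    refine ⟨?_, hfφ z ξ hξ⟩
    change 1 < ‖f (φ z ξ)‖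
    rw [hfφ z ξ hξ]
    exact one_lt_norm_exp hξ
  · intro z _ z' _ h
    have := eqOn_of_comp_eq_exp hf.entire hcrit (hφ z) (hfφ z) (hφ z') (hfφ z') hξ h h1H
    rw [hφ1, hφ1] at this
    exact Subtype.ext this
  · rintro x ⟨-, hx⟩
    obtain ⟨ψ, hψ, hψξ, hfψ⟩ := exists_comp_eq_exp hf.entire hcrit hasy hξ hx
    refine ⟨⟨ψ 1, hfψ 1 h1H⟩, mem_univ _, ?_⟩
    have := eqOn_of_comp_eq_exp hf.entire hcrit (hφ ⟨ψ 1, hfψ 1 h1H⟩) (hfφ _) hψ hfψ h1H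
      (hφ1 _) hξ
    exact this.trans hψξ
  · intro z ξ hξ a ha
    have hk := add_mul_two_pi_I_mem_halfPlane hξ
    have hval : ∀ k : ℕ, f (φ z (ξ + k * (2 * Real.pi * Complex.I))) = Complex.exp ξ := by
      intro k
      rw [hfφ z _ (hk k), Complex.exp_add, Complex.exp_nat_mul_two_pi_mul_I, mul_one]
    have hfa : f a = Complex.exp ξ := by
      have h1 := (hf.entire.continuous.tendsto a).comp ha
      refine tendsto_nhds_unique h1 (tendsto_const_nhds.congr fun k => (hval k).symm)
    have hd := hcrit a (by rw [hfa]; exact one_lt_norm_exp hξ)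
    -- f is injective near the limit a, so two consecutive terms, lying in the same fibre, would
    -- coincide.
    have hinv := ha.eventually
      (((hf.entire.analyticAt a).hasStrictDerivAt).eventually_left_inverse hd)
    obtain ⟨k, hk1, hk2⟩ := (hinv.and ((tendsto_add_atTop_nat 1).eventually hinv)).exists
    rw [hval] at hk1 hk2
    have h2 := (huni z).injOn (hk k) (hk (k + 1)) (hk1.symm.trans hk2)
    have h3 := mul_right_cancel₀ Complex.two_pi_I_ne_zero (add_left_cancel h2)
    have h4 : k = k + 1 := by exact_mod_cast h3
    omega

end LogTract

theorem mainTheorem7 (f : ℂ → ℂ) (U : Set ℂ)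
    (hf : LogTract.IsModelFunction f U ∨
      (LogTract.IsClassB f ∧ LogTract.singularSet f ⊆ Metric.ball 0 1 ∧
        U = f ⁻¹' {w | 1 < ‖w‖}))
    (h_zero : (0 : ℂ) ∉ U)
    (s : ℝ) (hs : 0 < s) (w₀ : ℂ) (hw₀ : 1 < ‖w₀‖)
    (hfin : ∀ t : ℝ, s < t → LogTract.transferOperator f U t 1 w₀ < ∞)
    (γ : ℝ) (hγ₀ : 0 < γ) (hγ₁ : γ < 1) :
    (∀ t : ℝ, s < t →
      ∃ M : NNReal, ∀ w : ℂ, Real.exp γ < ‖w‖ → LogTract.transferOperator f U t 1 w ≤ M) ∧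
    (∀ t p : ℝ, s < t → 1 < p → 1 / p < t / s - 1 →
      ∃ C : ℝ, ∀ w : ℂ, Real.exp γ < ‖w‖ →
        LogTract.transferOperator f U t 1 w ≤
          ENNReal.ofReal (C / (Real.log ‖w‖) ^ (1 / p))) := by
  rcases hf with ⟨τ, 𝒯, hτ, rfl, hf⟩ | ⟨hf, hS, rfl⟩
  · exact (hτ.isInverseBranchFamily hf).transferOperator_bounds h_zero hs hw₀ hfin hγ₀
  · obtain ⟨B, φ, hφ⟩ := hf.exists_isInverseBranchFamily hS
    exact hφ.transferOperator_bounds h_zero hs hw₀ hfin hγ₀
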